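/- For a meromorphic function $f\colon\mathbb{C}\to\hat{\mathbb{C}}$, let $f^n$ denote its $n$-th iterate ($f^0=\mathrm{id}$), where $f^{n}(z)$ is defined if and only if none of $z,f(z),\dots,f^{n-1}(z)$ equals $\infty$. The Fatou set $F(f)\subseteq\mathbb{C}$ is the largest open set on which all iterates of $f$ are defined and form a normal family with respect to the spherical metric; the Julia set is $J(f)=\mathbb{C}\setminus F(f)$; and the escaping set is $$I(f)=\{z\in\mathbb{C} : f^n(z)\text{ is defined for all } n\in\mathbb{N}\text{ and } f^n(z)\to\infty \text{ as } n\to\infty\}.$$ A component of a set is a connected component of it, closures, boundaries and interiors are taken in $\mathbb{C}$, and a wandering domain of $f$ is a component $U$ of $F(f)$ such that $f^m(U)\cap f^n(U)=\emptyset$ for all $m\neq n$, $m,n\geq 0$. **Theorem.** Let $K\subseteq\mathbb{C}$ be a compact set. Then there exists a transcendental (that is, non-rational) meromorphic function $f\colon\mathbb{C}\to\hat{\mathbb{C}}$ such that all iterates of $f$ are defined on $K$, $f^n|_K\to\infty$ uniformly as $n\to\infty$, and $f^n(K)\cap f^m(K)=\emptyset$ for all $n\neq m$, $n,m\ge 0$.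 Moreover: 1. Every component of $\partial K$ is a component of $J(f)$. 2. Every component of $K$ is a component of $I(f)$ and a component of $\overline{I(f)}$. 3. Every component of $\operatorname{int}(K)$ is a wandering domain of $f$. -/

import Mathlib

open Set Filter Topology Polynomial
open scoped OnePoint

namespace MeromorphicDynamics

/-- The Riemann sphere, as the one-point compactification of the complex plane. -/
abbrev Sphere : Type := OnePoint ℂ

/-- The uniform structure of the Riemann sphere. As the sphere is compact and Hausdorff, there is
exactly one uniform structure that induces its topology, so this is the uniform structure of the
spherical (equivalently, of the chordal) metric. -/
noncomputable instance instUniformSpaceSphere : UniformSpace (OnePoint ℂ) :=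
  uniformSpaceOfCompactR1

/-- `f : ℂ → Ĉ` is a meromorphic function on the whole plane: `f` is the continuous extension, with
values in the sphere, of a function that is meromorphic in the plane. In particular the poles are
exactly the points where the value is `∞`, and `f` is not identically `∞`. -/
def IsMeromorphic (f : ℂ → Sphere) : Prop :=
  ∃ g : ℂ → ℂ, Meromorphic g ∧ ∀ z : ℂ, Tendsto (fun w => (g w : Sphere)) (𝓝[≠] z) (𝓝 (f z))

/-- `f` is (the restriction to the plane of) a rational function: it agrees with a quotient `p / q`
of polynomials away from the finitely many zeros of `q`. -/
def IsRational (f : ℂ → Sphere) : Prop :=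
  ∃ p q : ℂ[X], q ≠ 0 ∧ ∀ z : ℂ, q.eval z ≠ 0 → f z = ((p.eval z / q.eval z : ℂ) : Sphere)

/-- A transcendental meromorphic function: meromorphic in the plane and not rational. -/
def IsTranscendentalMeromorphic (f : ℂ → Sphere) : Prop :=
  IsMeromorphic f ∧ ¬ IsRational f

/-- The `n`-th iterate `fⁿ(z)`, with `f⁰(z) = z` and `fⁿ⁺¹(z) = f (fⁿ(z))` if `fⁿ(z) ∈ ℂ`. It is
meaningful only for `z ∈ iterateDomain f n`; once the orbit has reached `∞`, where `f` is not
defined, the conventional value `∞` is kept. -/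
noncomputable def iter (f : ℂ → Sphere) : ℕ → ℂ → Sphere
  | 0, z => (z : Sphere)
  | n + 1, z => (iter f n z).elim ∞ f

/-- The set of points at which `fⁿ` is defined: none of `z, f(z), …, fⁿ⁻¹(z)` is `∞`. (The value
`fⁿ(z) = ∞` itself is allowed.) -/
def iterateDomain (f : ℂ → Sphere) (n : ℕ) : Set ℂ :=
  {z | ∀ k < n, iter f k z ≠ ∞}

/-- A family of sphere-valued functions is normal on `U`: every sequence in the family has a
subsequence that converges locally uniformly on `U` with respect to the spherical metric. -/
def IsNormalFamilyOn (𝓕 : Set (ℂ → Sphere)) (U : Set ℂ) : Prop :=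
  ∀ u : ℕ → ℂ → Sphere, (∀ k, u k ∈ 𝓕) →
    ∃ φ : ℕ → ℕ, StrictMono φ ∧ ∃ g : ℂ → Sphere,
      TendstoLocallyUniformlyOn (fun k => u (φ k)) g atTop U

/-- The Fatou set: the union of all open sets on which all iterates of `f` are defined and form a
normal family. -/
def fatouSet (f : ℂ → Sphere) : Set ℂ :=
  ⋃₀ {U | IsOpen U ∧ (∀ n, U ⊆ iterateDomain f n) ∧ IsNormalFamilyOn (Set.range (iter f)) U}

/-- The Julia set, the complement of the Fatou set in the plane. -/
def juliaSet (f : ℂ → Sphere) : Set ℂ := (fatouSet f)ᶜ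

/-- The escaping set: all iterates are defined at `z`, and `fⁿ(z) → ∞`. -/
def escapingSet (f : ℂ → Sphere) : Set ℂ :=
  {z | (∀ n, z ∈ iterateDomain f n) ∧ Tendsto (fun n => iter f n z) atTop (𝓝 ∞)}

/-- `C` is a connected component of the set `S`. -/
def IsComponentOf (C S : Set ℂ) : Prop := ∃ z ∈ S, C = connectedComponentIn S z

/-- A wandering domain of `f`: a Fatou component `U` whose images `fⁿ(U)`, `n ≥ 0`, are pairwise
disjoint. -/
def IsWanderingDomain (f : ℂ → Sphere) (U : Set ℂ) : Prop :=
  IsComponentOf U (fatouSet f) ∧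
    Pairwise fun m n : ℕ => Disjoint (iter f m '' U) (iter f n '' U)

end MeromorphicDynamics

/-! ### The Cauchy–Pompeiu formula for compactly supported functions. -/

section CauchyPompeiu

open MeasureTheory

/-! Surround the given compact set `L` by compact neighbourhoods `K n` shrinking to it, each inside
the interior of the previous one. A meromorphic `G` is built (`exists_meromorphic_tracks`) that
moves `K j` for `j` steps almost like the translation by `T`, but throws the frontier of `K j` at
step `j + 1` into a disc about `-T` on which `G` is a contraction. Thus `L` escapes uniformly, while
every frontier of a `K n` has a neighbourhood in an attracting basin, hence lies in the Fatou set
and off the closure of the escaping set.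

Everything else is soft. A connected set that meets `L` and misses all these frontiers stays in `L`;
this isolates the components of `L` and of its boundary. The frontiers accumulate at each boundary
point of `L`, so escaping and captured orbits mix there and normality fails. On the interior of `L`
the iterates tend uniformly to `∞`. Both behaviours occur arbitrarily far out, so `G` has no limit
at infinity and is not rational.

To build `G`, stage `j` adds a Runge approximant (`exists_meromorphic_approx`) that is tiny on a
disc around the earlier steps and prescribes new values near the `j`-th images of `K (j + 1)` and of
the frontier of `K j`. These images must be disjoint, so injectivity is carried through the
induction. Poles are allowed between the pieces, so the topology of `L` plays no role. Earlier
achievements survive later perturbations by `exists_forall_iterate_close` and shrinking tolerances.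
-/

/-- The Wirtinger derivative with respect to the conjugate variable. -/
noncomputable def dbar (g : ℂ → ℂ) (w : ℂ) : ℂ :=
  (fderiv ℝ g w 1 + Complex.I * fderiv ℝ g w Complex.I) / 2

/-- The map `v ↦ (D v + i D(i v)) / 2` is the conjugate-linear part of the derivative `D`. At a unit
vector `e` it is therefore `dbar` times the conjugate of `e`, which is `1 / e`. -/
theorem dbar_mul_exp (g : ℂ → ℂ) (w : ℂ) (θ : ℝ) :
    dbar g w / Complex.exp (θ * Complex.I) =
      (fderiv ℝ g w (Complex.exp (θ * Complex.I)) +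
        Complex.I * fderiv ℝ g w (Complex.I * Complex.exp (θ * Complex.I))) / 2 := by
  have h1 : Complex.exp (θ * Complex.I) =
      (Real.cos θ) • (1 : ℂ) + (Real.sin θ) • Complex.I := by
    rw [Complex.exp_mul_I]; simp
  have h2 : Complex.I * Complex.exp (θ * Complex.I) =
      (Real.cos θ) • Complex.I - (Real.sin θ) • (1 : ℂ) := by
    rw [h1]; simp only [Complex.real_smul]; linear_combination (Real.sin θ : ℂ) * Complex.I_mul_I
  rw [div_eq_iff (Complex.exp_ne_zero _), h2, h1, map_add, map_sub, map_smul, map_smul, map_smul,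
    map_smul, dbar]
  simp only [Complex.real_smul]
  have hcs : (Real.cos θ : ℂ) ^ 2 + (Real.sin θ : ℂ) ^ 2 = 1 := by
    exact_mod_cast Real.cos_sq_add_sin_sq θ
  have hI := Complex.I_mul_I
  generalize fderiv ℝ g w 1 = a
  generalize fderiv ℝ g w Complex.I = b
  generalize (Real.cos θ : ℂ) = c at *
  generalize (Real.sin θ : ℂ) = s at *
  linear_combination (-(a + Complex.I * b) / 2) * hcs +
    (a * s ^ 2 / 2 - b * c * s / 2) * hI

/-- In polar coordinates about `z` the Jacobian cancels the singularity, leaving half of a radial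
derivative `A` plus `i` times an angular derivative `B`. Along each ray `A` integrates to `-g z`; on
each circle `B` integrates to zero by periodicity. -/
theorem integral_dbar_div {g : ℂ → ℂ} (hg : ContDiff ℝ 1 g) (hc : HasCompactSupport g) (z : ℂ) :
    ∫ v, dbar g (z + v) / v = -(Real.pi : ℂ) * g z := by
  set e : ℝ → ℂ := fun θ => Complex.exp (θ * Complex.I) with he
  have hecont : Continuous e := by fun_prop
  have hD : Continuous (fderiv ℝ g) := hg.continuous_fderiv one_ne_zero
  have hen : ∀ θ, ‖e θ‖ = 1 := fun θ => Complex.norm_exp_ofReal_mul_I θ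
  set A : ℝ × ℝ → ℂ := fun p => fderiv ℝ g (z + p.1 * e p.2) (e p.2) with hA
  set B : ℝ × ℝ → ℂ := fun p => fderiv ℝ g (z + p.1 * e p.2) (Complex.I * e p.2) with hB
  have hAc : Continuous A := by
    apply Continuous.clm_apply <;> fun_prop
  have hBc : Continuous B := by
    apply Continuous.clm_apply <;> fun_prop
  obtain ⟨M, hM⟩ : ∃ M, ∀ w, M < ‖w - z‖ → fderiv ℝ g w = 0 := by
    obtain ⟨M, hM⟩ := hc.isCompact.isBounded.subset_closedBall z
    refine ⟨M, fun w hw => ?_⟩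
    by_contra h
    have : w ∈ tsupport g := tsupport_fderiv_subset ℝ (subset_tsupport _ h)
    have := hM this
    rw [Metric.mem_closedBall, dist_eq_norm] at this
    linarith
  set S : Set (ℝ × ℝ) := Ioi 0 ×ˢ Ioo (-Real.pi) Real.pi with hS
  have hSm : MeasurableSet S := measurableSet_Ioi.prod measurableSet_Ioo
  have key : ∀ C : ℝ × ℝ → ℂ, Continuous C → (∀ p, 0 < p.1 → M < p.1 → C p = 0) →
      IntegrableOn C S := by
    intro C hC h0
    have h1 : IntegrableOn C (S ∩ (Icc 0 M ×ˢ Icc (-Real.pi) Real.pi)) :=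
      (hC.continuousOn.integrableOn_compact (isCompact_Icc.prod isCompact_Icc)).mono_set
        inter_subset_right
    refine h1.of_forall_sdiff_eq_zero hSm ?_
    rintro p ⟨⟨hp1, hp2⟩, hp3⟩
    refine h0 p hp1 ?_
    by_contra! hle
    exact hp3 ⟨⟨hp1, hp2⟩, ⟨le_of_lt hp1, hle⟩, Ioo_subset_Icc_self hp2⟩
  have hnorm : ∀ p : ℝ × ℝ, 0 < p.1 → M < p.1 → fderiv ℝ g (z + p.1 * e p.2) = 0 := by
    intro p h0 hp
    apply hM
    rw [add_sub_cancel_left, norm_mul, hen, mul_one, Complex.norm_real, Real.norm_eq_abs,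
      abs_of_pos h0]
    exact hp
  have hAi : IntegrableOn A S := key A hAc fun p h0 hp => by simp [hA, hnorm p h0 hp]
  have hBi : IntegrableOn B S := key B hBc fun p h0 hp => by simp [hB, hnorm p h0 hp]
  have hgd : ∀ w, HasFDerivAt g (fderiv ℝ g w) w := fun w =>
    (hg.differentiable one_ne_zero w).hasFDerivAt
  have hAint : ∫ p in S, A p = -(2 * Real.pi : ℂ) * g z := by
    have h1 : ∀ θ : ℝ, ∫ r in Ioi (0 : ℝ), A (r, θ) = - g z := by
      intro θ
      have hd : ∀ r : ℝ, HasDerivAt (fun r : ℝ => g (z + r * e θ)) (A (r, θ)) r := by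
        intro r
        have h2 : HasDerivAt (fun r : ℝ => z + r * e θ) (e θ) r := by
          simpa using ((Complex.ofRealCLM.hasDerivAt (x := r)).mul_const (e θ)).const_add z
        exact (hgd (z + r * e θ)).comp_hasDerivAt r h2
      have hcd : ContDiff ℝ 1 (fun r : ℝ => g (z + r * e θ)) := by
        apply hg.comp
        exact contDiff_const.add (Complex.ofRealCLM.contDiff.mul contDiff_const)
      have hcs : HasCompactSupport (fun r : ℝ => g (z + r * e θ)) := by
        obtain ⟨N, hN⟩ := hc.isCompact.isBounded.subset_closedBall z
        refine HasCompactSupport.intro (isCompact_Icc (a := -N) (b := N)) fun r hr => ?_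
        by_contra h
        have := hN (subset_tsupport _ h)
        rw [Metric.mem_closedBall, dist_eq_norm, add_sub_cancel_left, norm_mul, hen, mul_one,
          Complex.norm_real, Real.norm_eq_abs, abs_le] at this
        exact hr this
      have := HasCompactSupport.integral_Ioi_deriv_eq hcd hcs 0
      simp only [(hd _).deriv] at this
      simpa using this
    have hi : IntegrableOn A S ((volume : Measure ℝ).prod volume) := hAi
    rw [Measure.volume_eq_prod, ← setIntegral_prod_swap]
    rw [setIntegral_prod]
    · simp only [Prod.swap_prod_mk, h1]
      simp only [setIntegral_const, Complex.real_smul]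
      rw [Measure.real, Real.volume_Ioo, ENNReal.toReal_ofReal (by linarith [Real.pi_pos])]
      push_cast; ring
    · exact hi.swap
  have hBint : ∫ p in S, B p = 0 := by
    rw [Measure.volume_eq_prod, hS, setIntegral_prod _ hBi]
    rw [setIntegral_eq_zero_of_forall_eq_zero]
    intro r hr
    have hr0 : (r : ℂ) ≠ 0 := by exact_mod_cast (ne_of_gt hr)
    have hd : ∀ θ : ℝ, HasDerivAt (fun θ : ℝ => g (z + r * e θ) / r) (B (r, θ)) θ := by
      intro θ
      have h1 : HasDerivAt e (Complex.I * e θ) θ := by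
        have := ((Complex.ofRealCLM.hasDerivAt (x := θ)).mul_const Complex.I).cexp
        simpa [he, mul_comm] using this
      have h2 : HasDerivAt (fun θ : ℝ => z + r * e θ) (r * (Complex.I * e θ)) θ := by
        simpa using (h1.const_mul (r : ℂ)).const_add z
      have h3 := ((hgd (z + r * e θ)).comp_hasDerivAt θ h2).div_const (r : ℂ)
      have h4 : (fderiv ℝ g (z + r * e θ)) (r * (Complex.I * e θ)) / r = B (r, θ) := by
        have h5 : (r : ℂ) * (Complex.I * e θ) = r • (Complex.I * e θ) := Complex.real_smul.symm
        rw [h5, map_smul, Complex.real_smul, mul_div_cancel_left₀ _ hr0]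
      rw [h4] at h3
      exact h3
    have h5 : Continuous fun θ => B (r, θ) := by fun_prop
    have := intervalIntegral.integral_eq_sub_of_hasDerivAt (fun θ _ => hd θ)
      (h5.intervalIntegrable (-Real.pi) Real.pi)
    rw [intervalIntegral.integral_of_le (by linarith [Real.pi_pos]),
      integral_Ioc_eq_integral_Ioo] at this
    rw [this]
    have : e Real.pi = e (-Real.pi) := by
      simp [he, Complex.exp_neg]
    rw [this, sub_self]
  rw [← Complex.integral_comp_polarCoord_symm]
  have : ∀ p ∈ Complex.polarCoord.target,
      p.1 • (dbar g (z + Complex.polarCoord.symm p) / Complex.polarCoord.symm p) =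
        (A p + Complex.I * B p) / 2 := by
    intro p hp
    have hp1 : (p.1 : ℂ) ≠ 0 := by exact_mod_cast (ne_of_gt hp.1)
    have hs : Complex.polarCoord.symm p = p.1 * e p.2 := by
      rw [Complex.polarCoord_symm_apply, he]
      simp only [Complex.exp_mul_I, Complex.ofReal_cos, Complex.ofReal_sin]
    rw [hs, ← dbar_mul_exp, Complex.real_smul]
    have : e p.2 ≠ 0 := Complex.exp_ne_zero _
    simp only [he] at this ⊢
    field_simp
  change ∫ p in S, _ = _
  rw [setIntegral_congr_fun hSm this, integral_div, integral_add hAi (hBi.const_mul _),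
    integral_const_mul, hAint, hBint]
  ring

end CauchyPompeiu

/-! ### Runge's theorem with poles. -/

section Runge

open MeasureTheory

theorem dbar_eq_zero_of_eventuallyEq {g h : ℂ → ℂ} {w : ℂ} (hgh : g =ᶠ[𝓝 w] h)
    (hh : DifferentiableAt ℂ h w) : dbar g w = 0 := by
  have h1 : fderiv ℝ g w = fderiv ℝ h w := hgh.fderiv_eq
  have h2 : fderiv ℝ h w = (fderiv ℂ h w).restrictScalars ℝ :=
    (hh.hasFDerivAt.restrictScalars ℝ).fderiv
  have h3 : fderiv ℂ h w Complex.I = Complex.I * fderiv ℂ h w 1 := by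
    rw [← smul_eq_mul, ← map_smul]; simp
  rw [dbar, h1, h2]
  simp only [ContinuousLinearMap.coe_restrictScalars', h3]
  linear_combination (fderiv ℂ h w 1 / 2) * Complex.I_mul_I

/-- The quotient map commutes with the integral and kills the integrand. This takes the place of
Riemann sums in Runge's theorem. -/
theorem integral_mem_of_isClosed_submodule {α E : Type*} [MeasurableSpace α] {μ : Measure α}
    [NormedAddCommGroup E] [NormedSpace ℂ E] [CompleteSpace E] (M : Submodule ℂ E)
    (hM : IsClosed (M : Set E)) {f : α → E} (hf : Integrable f μ) (hfM : ∀ x, f x ∈ M) :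
    ∫ x, f x ∂μ ∈ M := by
  have := hM
  have h := (M.mkQL).integral_comp_comm hf
  have h0 : ∀ x, M.mkQL (f x) = 0 := fun x => (Submodule.Quotient.mk_eq_zero M).2 (hfM x)
  simp only [h0, integral_zero] at h
  exact (Submodule.Quotient.mk_eq_zero M).1 h.symm

/-- A holomorphic function near a compact set `X` agrees on `X` with a compactly supported `C¹`
function whose `dbar`-derivative is supported in a given neighbourhood of `X` minus `X`. -/
theorem exists_contDiff_extension {X O : Set ℂ} (hX : IsCompact X) (hO : IsOpen O) (hXO : X ⊆ O)
    {F : ℂ → ℂ} (hF : DifferentiableOn ℂ F O) :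
    ∃ g : ℂ → ℂ, ContDiff ℝ 1 g ∧ HasCompactSupport g ∧ (∀ z ∈ X, g z = F z) ∧
      (∀ w, dbar g w ≠ 0 → w ∈ O) ∧ ∀ z ∈ X, ∀ᶠ w in 𝓝 z, dbar g w = 0 := by
  obtain ⟨t, ht, hXt, htO⟩ := exists_compact_between hX hO hXO
  obtain ⟨φ, hφ1, hφ0, -⟩ := exists_contMDiffMap_one_nhds_of_subset_interior
    (modelWithCornersSelf ℝ ℂ) (n := 1) hX.isClosed hXt
  have hφ : ContDiff ℝ 1 φ := φ.contMDiff.contDiff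
  have hg0 : ∀ z ∉ t, (φ z : ℂ) * F z = 0 := fun z hz => by simp [hφ0 z hz]
  have hg0' : ∀ z ∉ t, (fun z => (φ z : ℂ) * F z) =ᶠ[𝓝 z] fun _ => 0 := fun z hz => by
    filter_upwards [ht.isClosed.isOpen_compl.mem_nhds hz] with w hw using hg0 w hw
  refine ⟨fun z => (φ z : ℂ) * F z, ?_, HasCompactSupport.intro ht hg0, ?_, ?_, ?_⟩
  · rw [contDiff_iff_contDiffAt]
    intro z
    by_cases hz : z ∈ O
    · have h1 : ContDiffAt ℝ 1 F z :=
        ((hF.analyticOnNhd hO z hz).contDiffAt).restrict_scalars ℝ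
      exact (Complex.ofRealCLM.contDiff.contDiffAt.comp z hφ.contDiffAt).mul h1
    · exact contDiffAt_const.congr_of_eventuallyEq (hg0' z fun h => hz (htO h))
  · intro z hz
    have : φ z = 1 := hφ1.self_of_nhdsSet z hz
    simp [this]
  · intro w hw
    by_contra h
    exact hw (dbar_eq_zero_of_eventuallyEq (hg0' w fun h' => h (htO h'))
      (differentiableAt_const 0))
  · intro z hz
    have h1 : ∀ᶠ w in 𝓝 z, φ w = 1 := hφ1.filter_mono (nhds_le_nhdsSet hz)
    filter_upwards [h1.eventually_nhds, hO.mem_nhds (hXO hz)] with w hw hwO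
    refine dbar_eq_zero_of_eventuallyEq (h := F) ?_ (hF.differentiableAt (hO.mem_nhds hwO))
    filter_upwards [hw] with v hv
    simp [hv]

/-- **Runge's theorem**: a function holomorphic on an open set `O` can be approximated uniformly on
a compact set `X ⊆ O` by meromorphic functions with all poles in `O \ X`. -/
theorem exists_meromorphic_approx {X O : Set ℂ} (hX : IsCompact X) (hO : IsOpen O) (hXO : X ⊆ O)
    {F : ℂ → ℂ} (hF : DifferentiableOn ℂ F O) {ε : ℝ} (hε : 0 < ε) :
    ∃ r : ℂ → ℂ, Meromorphic r ∧ (∀ z ∈ X, AnalyticAt ℂ r z) ∧ (∀ z ∉ O, AnalyticAt ℂ r z) ∧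
      ∀ z ∈ X, ‖r z - F z‖ < ε := by
  obtain ⟨g, hg, hgc, hgF, hgO, hgX⟩ := exists_contDiff_extension hX hO hXO hF
  have huc : Continuous (dbar g) := by
    have := hg.continuous_fderiv one_ne_zero
    unfold dbar
    fun_prop
  have hus : HasCompactSupport (dbar g) := by
    refine HasCompactSupport.intro hgc.isCompact fun w hw => ?_
    have : g =ᶠ[𝓝 w] fun _ => 0 := notMem_tsupport_iff_eventuallyEq.1 hw
    exact dbar_eq_zero_of_eventuallyEq this (differentiableAt_const 0)
  have : CompactSpace X := isCompact_iff_compactSpace.1 hX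
  -- The Cauchy kernel is singular only for `w` in `X`, where `dbar g` vanishes on a neighbourhood.
  -- So it is a continuous family, indexed by `w`, of elements of `C(X, ℂ)`.
  have hFc : Continuous fun p : ℂ × X => dbar g p.1 * (p.1 - p.2)⁻¹ := by
    rw [continuous_iff_continuousAt]
    rintro ⟨w, z⟩
    by_cases hw : w ∈ X
    · have h0 : ∀ᶠ p : ℂ × X in 𝓝 (w, z), dbar g p.1 * (p.1 - p.2)⁻¹ = 0 := by
        have : Tendsto (fun p : ℂ × X => p.1) (𝓝 (w, z)) (𝓝 w) := continuousAt_fst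
        filter_upwards [this.eventually (hgX w hw)] with p hp
        simp [hp]
      exact (continuousAt_const (y := (0 : ℂ))).congr (h0.mono fun p hp => hp.symm)
    · refine ContinuousAt.mul (by fun_prop) (ContinuousAt.inv₀ (by fun_prop) ?_)
      exact sub_ne_zero.2 fun h => hw (by simp only at h; rw [h]; exact z.2)
  let Φ : C(ℂ, C(X, ℂ)) := ContinuousMap.curry ⟨_, hFc⟩
  have hΦ : ∀ w z, Φ w z = dbar g w * (w - z)⁻¹ := fun w z => rfl
  have hΦi : Integrable Φ := by
    refine Φ.continuous.integrable_of_hasCompactSupport ?_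
    refine hus.mono fun w hw h => hw ?_
    ext z
    rw [hΦ, h, zero_mul]; rfl
  -- The admissible approximants form a subspace containing every kernel; the Cauchy–Pompeiu
  -- integral, which gives `F` up to a constant, then lies in its closure.
  let N : Submodule ℂ C(X, ℂ) :=
    { carrier := {p | ∃ r : ℂ → ℂ, Meromorphic r ∧ (∀ z ∈ X, AnalyticAt ℂ r z) ∧
        (∀ z ∉ O, AnalyticAt ℂ r z) ∧ ∀ z : X, p z = r z}
      add_mem' := by
        rintro p q ⟨r, h1, h2, h3, h4⟩ ⟨s, k1, k2, k3, k4⟩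
        exact ⟨fun z => r z + s z, fun z => (h1 z).add (k1 z),
          fun z hz => (h2 z hz).add (k2 z hz), fun z hz => (h3 z hz).add (k3 z hz),
          fun z => by simp [h4, k4]⟩
      zero_mem' := ⟨fun _ => 0, fun z => analyticAt_const.meromorphicAt,
        fun z _ => analyticAt_const, fun z _ => analyticAt_const, fun z => rfl⟩
      smul_mem' := by
        rintro c p ⟨r, h1, h2, h3, h4⟩
        exact ⟨fun z => c * r z, fun z => analyticAt_const.meromorphicAt.mul (h1 z),
          fun z hz => analyticAt_const.mul (h2 z hz), fun z hz => analyticAt_const.mul (h3 z hz),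
          fun z => by simp [h4]⟩ }
  have hΦN : ∀ w, Φ w ∈ N.topologicalClosure := by
    intro w
    refine Submodule.le_topologicalClosure _ ?_
    by_cases hw : dbar g w = 0
    · have : Φ w = 0 := by ext z; rw [hΦ, hw, zero_mul]; rfl
      rw [this]; exact N.zero_mem
    · have hwX : w ∉ X := fun h => hw (hgX w h).self_of_nhds
      have hwO := hgO w hw
      have key : ∀ z, z ≠ w → AnalyticAt ℂ (fun z => dbar g w * (w - z)⁻¹) z := fun z hz =>
        analyticAt_const.mul ((analyticAt_const.sub analyticAt_id).inv (sub_ne_zero.2 hz.symm))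
      refine ⟨fun z => dbar g w * (w - z)⁻¹, fun z => ?_, fun z hz => key z ?_, fun z hz => key z ?_,
        fun z => hΦ w z⟩
      · exact analyticAt_const.meromorphicAt.mul
          (analyticAt_const.sub analyticAt_id).meromorphicAt.inv
      · rintro rfl; exact hwX hz
      · rintro rfl; exact hz hwO
  have hmem := integral_mem_of_isClosed_submodule _ N.isClosed_topologicalClosure hΦi hΦN
  have hev : ∀ z : X, (∫ w, Φ w) z = -(Real.pi : ℂ) * F z := by
    intro z
    rw [ContinuousMap.integral_apply hΦi]
    rw [← hgF z z.2, ← integral_dbar_div hg hgc, ← integral_add_left_eq_self _ (z : ℂ)]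
    simp only [hΦ, add_sub_cancel_left, div_eq_mul_inv]
  have hpi : (-(Real.pi : ℂ)) ≠ 0 := neg_ne_zero.2 (by exact_mod_cast Real.pi_ne_zero)
  have hmem' := N.topologicalClosure.smul_mem (-(Real.pi : ℂ))⁻¹ hmem
  obtain ⟨p, ⟨r, h1, h2, h3, h4⟩, hp⟩ := Metric.mem_closure_iff.1 hmem' ε hε
  refine ⟨r, h1, h2, h3, fun z hz => ?_⟩
  have h5 := (ContinuousMap.dist_lt_iff hε).1 hp ⟨z, hz⟩
  rw [h4, ContinuousMap.smul_apply, hev, smul_eq_mul, inv_mul_cancel_left₀ hpi, dist_comm,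
    dist_eq_norm] at h5
  exact h5

end Runge

/-! ### Stability of iterates, and one Runge correction. -/

section Tracking

open Metric

/-- Points closer than `τ` are handled by the Schwarz lemma, the others by the trivial bound `2 *
ε`. It turns smallness of a holomorphic perturbation into a small Lipschitz constant, with no
convexity assumed. -/
theorem norm_sub_le_of_norm_le_of_ball {h : ℂ → ℂ} {S D : Set ℂ} {τ ε : ℝ} (hτ : 0 < τ)
    (hSD : ∀ z ∈ S, ball z τ ⊆ D) (hd : DifferentiableOn ℂ h D) (hb : ∀ z ∈ D, ‖h z‖ ≤ ε)
    {z w : ℂ} (hz : z ∈ S) (hw : w ∈ S) : ‖h z - h w‖ ≤ 2 * ε / τ * ‖z - w‖ := by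
  have hD : ∀ z ∈ S, z ∈ D := fun z hz => hSD z hz (mem_ball_self hτ)
  have h2 : ∀ x ∈ D, ∀ y ∈ D, ‖h x - h y‖ ≤ 2 * ε := fun x hx y hy => by
    linarith [norm_sub_le (h x) (h y), hb x hx, hb y hy]
  by_cases hzw : z ∈ ball w τ
  · have := Complex.dist_le_div_mul_dist_of_mapsTo_ball (hd.mono (hSD w hw)) (R₂ := 2 * ε)
      (fun x hx => by
        rw [mem_closedBall, dist_eq_norm]
        exact h2 x (hSD w hw hx) w (hD w hw)) hzw
    rwa [dist_eq_norm, dist_eq_norm] at this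
  · rw [mem_ball, dist_eq_norm, not_lt] at hzw
    have h3 := h2 z (hD z hz) w (hD w hw)
    have hε : 0 ≤ 2 * ε := (norm_nonneg _).trans h3
    calc ‖h z - h w‖ ≤ 2 * ε := h3
      _ = 2 * ε / τ * τ := by field_simp
      _ ≤ _ := by gcongr

theorem continuousOn_iterate {f : ℂ → ℂ} {S : Set ℂ} {j : ℕ}
    (hf : ∀ z ∈ S, ∀ i < j, ContinuousAt f (f^[i] z)) : ContinuousOn f^[j] S := by
  induction j with
  | zero => exact continuousOn_id
  | succ j ih =>
    rw [Function.iterate_succ']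
    intro z hz
    exact (hf z hz j (Nat.lt_succ_self j)).comp_continuousWithinAt
      (ih (fun z hz i hi => hf z hz i (hi.trans (Nat.lt_succ_self j))) z hz)

/-- Induction on `j`: the `j`-th image of `S` is compact, so `f` is uniformly continuous near it and
a whole thickening of it lies in `O`, where `G` is still controlled. -/
theorem exists_forall_iterate_close {f : ℂ → ℂ} {S O : Set ℂ} (hS : IsCompact S) (hO : IsOpen O)
    {j : ℕ} (hf : ∀ z ∈ S, ∀ i < j, ContinuousAt f (f^[i] z)) (hfO : ∀ z ∈ S, ∀ i < j, f^[i] z ∈ O)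
    {τ : ℝ} (hτ : 0 < τ) :
    ∃ δ > 0, ∀ G : ℂ → ℂ, (∀ x ∈ O, ‖G x - f x‖ ≤ δ) → ∀ z ∈ S, ‖G^[j] z - f^[j] z‖ < τ := by
  induction j generalizing τ with
  | zero => exact ⟨1, one_pos, fun G _ z _ => by simpa using hτ⟩
  | succ j ih =>
    have hf' : ∀ z ∈ S, ∀ i < j, ContinuousAt f (f^[i] z) :=
      fun z hz i hi => hf z hz i (hi.trans (Nat.lt_succ_self j))
    have hC : IsCompact (f^[j] '' S) := hS.image_of_continuousOn (continuousOn_iterate hf')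
    obtain ⟨δ₁, hδ₁, h1⟩ := Metric.mem_uniformity_dist.1
      (hC.uniformContinuousAt_of_continuousAt f
        (by rintro _ ⟨z, hz, rfl⟩; exact hf z hz j (Nat.lt_succ_self j))
        (Metric.dist_mem_uniformity (half_pos hτ)))
    obtain ⟨δ₂, hδ₂, h2⟩ := hC.exists_thickening_subset_open hO
      (by rintro _ ⟨z, hz, rfl⟩; exact hfO z hz j (Nat.lt_succ_self j))
    obtain ⟨δ₃, hδ₃, h3⟩ := ih hf' (fun z hz i hi => hfO z hz i (hi.trans (Nat.lt_succ_self j)))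
      (lt_min hδ₁ hδ₂)
    refine ⟨min δ₃ (τ / 2), lt_min hδ₃ (half_pos hτ), fun G hG z hz => ?_⟩
    have h4 := h3 G (fun x hx => (hG x hx).trans (min_le_left _ _)) z hz
    have hmem : f^[j] z ∈ f^[j] '' S := mem_image_of_mem _ hz
    have h5 : dist (f (f^[j] z)) (f (G^[j] z)) < τ / 2 :=
      h1 (a := f^[j] z) (b := G^[j] z)
        (by rw [dist_comm, dist_eq_norm]; exact h4.trans_le (min_le_left _ _)) hmem
    have h6 : G^[j] z ∈ O := h2 (mem_thickening_iff.2 ⟨_, hmem, by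
      rw [dist_eq_norm]; exact h4.trans_le (min_le_right _ _)⟩)
    have h7 := (hG _ h6).trans (min_le_right _ _)
    rw [Function.iterate_succ_apply', Function.iterate_succ_apply']
    rw [dist_comm, dist_eq_norm] at h5
    calc ‖G (G^[j] z) - f (f^[j] z)‖
        = ‖(G (G^[j] z) - f (G^[j] z)) + (f (G^[j] z) - f (f^[j] z))‖ := by ring_nf
      _ ≤ _ := norm_add_le _ _
      _ < τ := by linarith

/-- On the open set `O`, the function `G` is a holomorphic perturbation of `f` of size at most
`η`. -/
def IsPerturbationOn (f G : ℂ → ℂ) (O : Set ℂ) (η : ℝ) : Prop :=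
  DifferentiableOn ℂ (fun z => G z - f z) O ∧ ∀ z ∈ O, ‖G z - f z‖ ≤ η

theorem IsPerturbationOn.analyticAt {f G : ℂ → ℂ} {O : Set ℂ} {η : ℝ}
    (h : IsPerturbationOn f G O η) (hO : IsOpen O) {z : ℂ} (hz : z ∈ O) (hf : AnalyticAt ℂ f z) :
    AnalyticAt ℂ G z := by
  have := hf.add (h.1.analyticOnNhd hO z hz)
  exact this.congr (Eventually.of_forall fun w => by simp)

theorem IsPerturbationOn.meromorphicAt {f G : ℂ → ℂ} {O : Set ℂ} {η : ℝ}
    (h : IsPerturbationOn f G O η) (hO : IsOpen O) {z : ℂ} (hz : z ∈ O)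
    (hf : MeromorphicAt f z) : MeromorphicAt G z := by
  have := hf.add (h.1.analyticOnNhd hO z hz).meromorphicAt
  exact this.congr (Eventually.of_forall fun w => by simp)

/-- The first `j` iterates of `G` are injective on `K j` and close to translations by multiples of
`T`, while the boundary of `K i` for `i < j` is mapped by the iterate `i + 1` into a small disc
centred at `-T`. -/
structure Tracks (K : ℕ → Set ℂ) (T : ℝ) (j : ℕ) (G : ℂ → ℂ) : Prop where
  close : ∀ z ∈ K j, ∀ i ≤ j, ‖G^[i] z - z - i * T‖ ≤ 1 - (1 / 2) ^ j
  analytic : ∀ z ∈ K j, ∀ i < j, AnalyticAt ℂ G (G^[i] z)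
  captured : ∀ i < j, ∀ z ∈ frontier (K i),
    AnalyticAt ℂ G (G^[i] z) ∧ ‖G^[i + 1] z + T‖ ≤ 1 / 2
  injOn : InjOn G^[j] (K j)

/-- A partial construction: every holomorphic perturbation of `f` of size `η` on a large disc has
the tracking property. -/
structure IsStage (K : ℕ → Set ℂ) (T : ℝ) (j : ℕ) (f : ℂ → ℂ) (η : ℝ) : Prop where
  pos : 0 < η
  meromorphic : Meromorphic f
  analytic : ∀ z : ℂ, j * T + T / 2 ≤ ‖z + T‖ → AnalyticAt ℂ f z
  tracks : ∀ G, IsPerturbationOn f G (ball (-T : ℂ) (j * T + T / 2 + 1)) η → Tracks K T j G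

variable {K : ℕ → Set ℂ} {R T : ℝ}

/-- The correction added to `f` approximates `0` on the old disc, `z + T - f z` near `A` and `-T - f
z` near `B`. New poles can only lie between these pieces, inside the disc of radius `(j + 1) * T + T
/ 2` about `-T`, so the next stage again starts out analytic farther away. -/
theorem IsStage.exists_approx (hR : 0 ≤ R) (hT : T = 2 * R + 10) {j : ℕ}
    {f : ℂ → ℂ} (hm : Meromorphic f) (hfa : ∀ z : ℂ, j * T + T / 2 ≤ ‖z + T‖ → AnalyticAt ℂ f z)
    {A B : Set ℂ} (hA : IsCompact A) (hB : IsCompact B)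
    (hAR : A ⊆ closedBall (j * T : ℂ) (R + 1)) (hBR : B ⊆ closedBall (j * T : ℂ) (R + 1))
    {τ : ℝ} (hτ1 : τ ≤ 1 / 3) (hτ0 : 0 < τ)
    (hdisj : Disjoint (thickening (3 * τ) A) (thickening (3 * τ) B)) {ε : ℝ} (hε : 0 < ε) :
    ∃ f' : ℂ → ℂ, Meromorphic f' ∧
      (∀ z : ℂ, (j + 1 : ℕ) * T + T / 2 ≤ ‖z + T‖ → AnalyticAt ℂ f' z) ∧
      IsPerturbationOn f f' (ball (-T : ℂ) (j * T + T / 2 + 1)) ε ∧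
      (∀ z ∈ thickening (2 * τ) A, AnalyticAt ℂ f' z ∧ ‖f' z - z - T‖ ≤ ε) ∧
      (∀ z ∈ thickening (2 * τ) B, AnalyticAt ℂ f' z ∧ ‖f' z + T‖ ≤ ε) := by
  have hT0 : 0 < T := by linarith
  -- Since `3 * τ ≤ 1`, such points lie within `R + 2 = T / 2 - 3` of `j * T`, whose distance to
  -- `-T` is `(j + 1) * T`.
  have hfar : ∀ {C : Set ℂ}, C ⊆ closedBall (j * T : ℂ) (R + 1) → ∀ z ∈ thickening (3 * τ) C,
      j * T + T / 2 + 3 ≤ ‖z + T‖ ∧ ‖z + T‖ < (j + 1 : ℕ) * T + T / 2 := by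
    intro C hC z hz
    obtain ⟨w, hw, hzw⟩ := mem_thickening_iff.1 hz
    have h1 := hC hw
    rw [mem_closedBall, dist_eq_norm] at h1
    rw [dist_eq_norm] at hzw
    have h2 : ‖((j : ℂ) + 1) * T‖ = (j + 1) * T := by
      have : ((j : ℂ) + 1) * T = (((j + 1) * T : ℝ) : ℂ) := by push_cast; ring
      rw [this, Complex.norm_real, Real.norm_of_nonneg (by positivity)]
    have h3 : ‖z + T‖ ≤ (j + 1) * T + (‖z - w‖ + ‖w - j * T‖) := by
      rw [← h2]
      calc ‖z + T‖ = ‖((j : ℂ) + 1) * T + ((z - w) + (w - j * T))‖ := by ring_nf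
        _ ≤ _ := (norm_add_le _ _).trans (by gcongr; exact norm_add_le _ _)
    have h4 : (j + 1) * T - (‖z - w‖ + ‖w - j * T‖) ≤ ‖z + T‖ := by
      rw [← h2]
      have : ‖((j : ℂ) + 1) * T‖ = ‖(z + T) - ((z - w) + (w - j * T))‖ := by ring_nf
      rw [this]
      have h5 := norm_sub_le (z + T) ((z - w) + (w - j * T))
      have h6 := norm_add_le (z - w) (w - j * T)
      linarith
    push_cast
    constructor <;> linarith
  have hsub : ∀ C : Set ℂ, thickening (2 * τ) C ⊆ cthickening (2 * τ) C :=
    fun C => thickening_subset_cthickening _ _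
  have hsub' : ∀ C : Set ℂ, cthickening (2 * τ) C ⊆ thickening (3 * τ) C := fun C =>
    cthickening_subset_thickening' (by positivity) (by linarith) C
  set O₀ : Set ℂ := ball (-T : ℂ) (j * T + T / 2 + 2) with hO₀
  have hO₀mem : ∀ z, z ∈ O₀ ↔ ‖z + T‖ < j * T + T / 2 + 2 := fun z => by
    rw [hO₀, mem_ball, dist_eq_norm, sub_neg_eq_add]
  have hOA : ∀ z ∈ thickening (3 * τ) A, z ∉ O₀ := fun z hz h => by
    linarith [(hO₀mem z).1 h, (hfar hAR z hz).1]
  have hOB : ∀ z ∈ thickening (3 * τ) B, z ∉ O₀ := fun z hz h => by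
    linarith [(hO₀mem z).1 h, (hfar hBR z hz).1]
  classical
  set F : ℂ → ℂ := fun z => if z ∈ O₀ then 0 else
    if z ∈ thickening (3 * τ) A then z + T - f z else -T - f z with hF
  have hF0 : EqOn F (fun _ => 0) O₀ := fun z hz => by simp [hF, hz]
  have hFA : EqOn F (fun z => z + T - f z) (thickening (3 * τ) A) := fun z hz => by
    simp [hF, hz, hOA z hz]
  have hFB : EqOn F (fun z => -T - f z) (thickening (3 * τ) B) := fun z hz => by
    simp [hF, hOB z hz, disjoint_right.1 hdisj hz]
  have hfd : ∀ {C : Set ℂ}, C ⊆ closedBall (j * T : ℂ) (R + 1) → ∀ z ∈ thickening (3 * τ) C,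
      AnalyticAt ℂ f z := fun hC z hz => hfa z (by linarith [(hfar hC z hz).1])
  have hFd : DifferentiableOn ℂ F (O₀ ∪ (thickening (3 * τ) A ∪ thickening (3 * τ) B)) := by
    have h0 : DifferentiableOn ℂ F O₀ := (differentiableOn_const 0).congr hF0
    have h1 : DifferentiableOn ℂ F (thickening (3 * τ) A) := by
      refine DifferentiableOn.congr (fun z hz => ?_) hFA
      exact ((differentiableAt_id.add_const _).sub
        (hfd hAR z hz).differentiableAt).differentiableWithinAt
    have h2 : DifferentiableOn ℂ F (thickening (3 * τ) B) := by
      refine DifferentiableOn.congr (fun z hz => ?_) hFB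
      exact ((differentiableAt_const _).sub
        (hfd hBR z hz).differentiableAt).differentiableWithinAt
    exact h0.union_of_isOpen (h1.union_of_isOpen h2 isOpen_thickening isOpen_thickening)
      isOpen_ball (isOpen_thickening.union isOpen_thickening)
  have hX : IsCompact (closedBall (-T : ℂ) (j * T + T / 2 + 1) ∪
      (cthickening (2 * τ) A ∪ cthickening (2 * τ) B)) :=
    (isCompact_closedBall _ _).union (hA.cthickening.union hB.cthickening)
  have hX0 : ∀ z ∈ closedBall (-T : ℂ) (j * T + T / 2 + 1), z ∈ O₀ := fun z hz =>
    (closedBall_subset_ball (by linarith)) hz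
  obtain ⟨r, hr, hrX, hrO, hrF⟩ := exists_meromorphic_approx hX
    (isOpen_ball.union (isOpen_thickening.union isOpen_thickening))
    (union_subset_union hX0 (union_subset_union (hsub' A) (hsub' B))) hFd hε
  refine ⟨fun z => f z + r z, fun z => (hm z).add (hr z), ?_, ⟨?_, ?_⟩, ?_, ?_⟩
  · intro z hz
    have h1 : (j : ℝ) * T + T / 2 + T ≤ ‖z + T‖ := by push_cast at hz; linarith
    refine (hfa z (by linarith)).add (hrO z ?_)
    rintro (h | h | h)
    · linarith [(hO₀mem z).1 h]
    · linarith [(hfar hAR z h).2]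
    · linarith [(hfar hBR z h).2]
  · simp only [add_sub_cancel_left]
    exact fun z hz => (hrX z (Or.inl (ball_subset_closedBall hz))).differentiableAt
      |>.differentiableWithinAt
  · intro z hz
    have hz' := ball_subset_closedBall hz
    have := hrF z (Or.inl hz')
    rw [hF0 (hX0 z hz'), sub_zero] at this
    simpa using this.le
  · intro z hz
    have h3 := hsub' A (hsub A hz)
    have h4 := Or.inr (a := z ∈ closedBall (-T : ℂ) (j * T + T / 2 + 1))
      (Or.inl (b := z ∈ cthickening (2 * τ) B) (hsub A hz))
    refine ⟨(hfd hAR z h3).add (hrX z h4), ?_⟩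
    have := (hrF z h4).le
    rw [hFA h3] at this
    rwa [show r z - (z + T - f z) = f z + r z - z - T by ring] at this
  · intro z hz
    have h3 := hsub' B (hsub B hz)
    have h4 := Or.inr (a := z ∈ closedBall (-T : ℂ) (j * T + T / 2 + 1))
      (Or.inr (a := z ∈ cthickening (2 * τ) A) (hsub B hz))
    refine ⟨(hfd hBR z h3).add (hrX z h4), ?_⟩
    have := (hrF z h4).le
    rw [hFB h3] at this
    rwa [show r z - (-T - f z) = f z + r z + T by ring] at this

end Tracking

/-! ### The inductive construction and its limit. -/

section Construction

open Metric

variable {K : ℕ → Set ℂ} {R T : ℝ}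

theorem IsPerturbationOn.trans {f g h : ℂ → ℂ} {O O' : Set ℂ} {η η' : ℝ}
    (h1 : IsPerturbationOn f g O η) (h2 : IsPerturbationOn g h O' η') (hO : O ⊆ O') :
    IsPerturbationOn f h O (η + η') := by
  refine ⟨((h1.1.add (h2.1.mono hO))).congr fun z _ => by simp, fun z hz => ?_⟩
  calc ‖h z - f z‖ = ‖(g z - f z) + (h z - g z)‖ := by ring_nf
    _ ≤ _ := (norm_add_le _ _).trans (add_le_add (h1.2 z hz) (h2.2 z (hO hz)))

theorem IsPerturbationOn.mono {f g : ℂ → ℂ} {O O' : Set ℂ} {η η' : ℝ}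
    (h : IsPerturbationOn f g O η) (hO : O' ⊆ O) (hη : η ≤ η') : IsPerturbationOn f g O' η' :=
  ⟨h.1.mono hO, fun z hz => (h.2 z (hO hz)).trans hη⟩

theorem IsPerturbationOn.refl (f : ℂ → ℂ) (O : Set ℂ) {η : ℝ} (hη : 0 ≤ η) :
    IsPerturbationOn f f O η := by
  refine ⟨(differentiableOn_const (0 : ℂ)).congr fun z _ => by simp, fun z _ => by simpa⟩

/-- Near `A` the map is a translation plus a holomorphic error of Lipschitz constant at most `2 * σ
/ τ ≤ 1 / 2`, hence injective there. The new displacement error `(1 / 2) ^ (j + 1)` is exactly what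
the bound `1 - (1 / 2) ^ j` leaves room for. -/
theorem Tracks.succ {j : ℕ} {G : ℂ → ℂ} (hKj : K (j + 1) ⊆ K j) (hG : Tracks K T j G)
    {A B : Set ℂ} {τ σ : ℝ} (hτ : 0 < τ) (hA : ∀ z ∈ K (j + 1), G^[j] z ∈ thickening τ A)
    (hB : ∀ z ∈ frontier (K j), G^[j] z ∈ thickening (2 * τ) B) (hστ : σ ≤ τ / 4)
    (hσ : σ ≤ (1 / 2) ^ (j + 1))
    (hGA : ∀ z ∈ thickening (2 * τ) A, AnalyticAt ℂ G z ∧ ‖G z - z - T‖ ≤ σ)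
    (hGB : ∀ z ∈ thickening (2 * τ) B, AnalyticAt ℂ G z ∧ ‖G z + T‖ ≤ σ) :
    Tracks K T (j + 1) G := by
  have hsub : thickening τ A ⊆ thickening (2 * τ) A := thickening_mono (by linarith) A
  have hpow : ((1 : ℝ) / 2) ^ (j + 1) = (1 / 2) ^ j / 2 := by rw [pow_succ]; ring
  have hpow0 : (0 : ℝ) < (1 / 2) ^ j := by positivity
  have hpow1 : ((1 : ℝ) / 2) ^ j ≤ 1 := pow_le_one₀ (by norm_num) (by norm_num)
  refine ⟨?_, ?_, ?_, ?_⟩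
  · intro z hz i hi
    rcases Nat.lt_or_eq_of_le hi with hi | rfl
    · have := hG.close z (hKj hz) i (Nat.lt_succ_iff.1 hi)
      linarith
    · rw [Function.iterate_succ_apply']
      have h1 := hG.close z (hKj hz) j le_rfl
      have h2 := (hGA _ (hsub (hA z hz))).2
      push_cast
      calc ‖G (G^[j] z) - z - (j + 1) * T‖
          = ‖(G (G^[j] z) - G^[j] z - T) + (G^[j] z - z - j * T)‖ := by ring_nf
        _ ≤ _ := norm_add_le _ _
        _ ≤ _ := by linarith
  · intro z hz i hi
    rcases Nat.lt_or_eq_of_le (Nat.lt_succ_iff.1 hi) with hi | rfl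
    · exact hG.analytic z (hKj hz) i hi
    · exact (hGA _ (hsub (hA z hz))).1
  · intro i hi z hz
    rcases Nat.lt_or_eq_of_le (Nat.lt_succ_iff.1 hi) with hi | rfl
    · exact hG.captured i hi z hz
    · have h1 := hGB _ (hB z hz)
      refine ⟨h1.1, ?_⟩
      rw [Function.iterate_succ_apply']
      linarith [h1.2]
  · intro z hz w hw hzw
    rw [Function.iterate_succ_apply', Function.iterate_succ_apply'] at hzw
    refine hG.injOn (hKj hz) (hKj hw) ?_
    have h1 := norm_sub_le_of_norm_le_of_ball (h := fun z => G z - z - T) (ε := σ)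
      (S := thickening τ A) (D := thickening (2 * τ) A) hτ ?_ ?_ (fun z hz => (hGA z hz).2) (hA z hz) (hA w hw)
    · simp only [hzw] at h1
      have h2 : ‖G (G^[j] w) - G^[j] z - T - (G (G^[j] w) - G^[j] w - T)‖ =
          ‖G^[j] z - G^[j] w‖ := by rw [← norm_neg]; ring_nf
      rw [h2] at h1
      have h3 : 2 * σ / τ ≤ 1 / 2 := by rw [div_le_iff₀ hτ]; linarith
      have h4 := h1.trans (mul_le_mul_of_nonneg_right h3 (norm_nonneg _))
      have h5 := norm_nonneg (G^[j] z - G^[j] w)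
      exact sub_eq_zero.1 (norm_eq_zero.1 (by linarith))
    · intro x hx y hy
      obtain ⟨a, ha, hxa⟩ := mem_thickening_iff.1 hx
      exact mem_thickening_iff.2 ⟨a, ha, (dist_triangle y x a).trans_lt (by
        rw [mem_ball] at hy; linarith)⟩
    · intro x hx
      exact (((hGA x hx).1.differentiableAt.sub differentiableAt_id).sub_const
        _).differentiableWithinAt

theorem norm_add_lt_of_close {j i : ℕ} (hR : 0 ≤ R) (hT : T = 2 * R + 10) (hij : i ≤ j) {z x : ℂ}
    (hz : ‖z‖ ≤ R) (hx : ‖x - z - i * T‖ ≤ 1) : ‖x + T‖ < (j + 1 : ℕ) * T + T / 2 := by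
  have hT0 : 0 < T := by linarith
  have h2 : ‖((i : ℂ) + 1) * T‖ = (i + 1) * T := by
    have : ((i : ℂ) + 1) * T = (((i + 1) * T : ℝ) : ℂ) := by push_cast; ring
    rw [this, Complex.norm_real, Real.norm_of_nonneg (by positivity)]
  have h3 : ((i : ℝ) + 1) * T ≤ (j + 1) * T := by
    have : (i : ℝ) ≤ j := by exact_mod_cast hij
    gcongr
  have h4 : ‖x + T‖ ≤ (i + 1) * T + (‖x - z - i * T‖ + ‖z‖) := by
    rw [← h2]
    calc ‖x + T‖ = ‖((i : ℂ) + 1) * T + ((x - z - i * T) + z)‖ := by ring_nf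
      _ ≤ _ := (norm_add_le _ _).trans (by gcongr; exact norm_add_le _ _)
  push_cast
  linarith

/-- Injectivity of `f^[j]` on `K j` separates the images `A` and `B`, so they can be sent to
different places. Half of `σ` is spent on the change from `f` to `f'`; the other half remains as
tolerance for all later changes. -/
theorem IsStage.succ (hR : 0 ≤ R) (hT : T = 2 * R + 10) (hKc : ∀ n, IsCompact (K n))
    (hK : ∀ n, K (n + 1) ⊆ interior (K n)) (hKR : ∀ n, K n ⊆ closedBall 0 R) {j : ℕ} {f : ℂ → ℂ}
    {η : ℝ} (hf : IsStage K T j f η) :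
    ∃ f' η', IsStage K T (j + 1) f' η' ∧ η' ≤ η / 2 ∧
      IsPerturbationOn f f' (ball (-T : ℂ) (j * T + T / 2 + 1)) (η / 2) := by
  have hT0 : 0 < T := by linarith
  have hKj : K (j + 1) ⊆ K j := (hK j).trans interior_subset
  have hfr : frontier (K j) ⊆ K j := (hKc j).isClosed.frontier_subset
  have hft := hf.tracks f (IsPerturbationOn.refl f _ hf.pos.le)
  have hcont : ContinuousOn f^[j] (K j) :=
    continuousOn_iterate fun z hz i hi => (hft.analytic z hz i hi).continuousAt
  have hclose : ∀ z ∈ K j, ∀ i ≤ j, ‖f^[i] z - z - i * T‖ ≤ 1 := fun z hz i hi =>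
    (hft.close z hz i hi).trans (by linarith [show (0 : ℝ) < (1 / 2) ^ j by positivity])
  have hz0 : ∀ z ∈ K j, ‖z‖ ≤ R := fun z hz => by simpa using hKR j hz
  set A := f^[j] '' K (j + 1) with hAdef
  set B := f^[j] '' frontier (K j) with hBdef
  have hA : IsCompact A := (hKc _).image_of_continuousOn (hcont.mono hKj)
  have hB : IsCompact B :=
    ((hKc j).of_isClosed_subset isClosed_frontier hfr).image_of_continuousOn (hcont.mono hfr)
  have hloc : f^[j] '' K j ⊆ closedBall (j * T : ℂ) (R + 1) := by
    rintro _ ⟨z, hz, rfl⟩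
    rw [mem_closedBall, dist_eq_norm]
    calc ‖f^[j] z - j * T‖ = ‖(f^[j] z - z - j * T) + z‖ := by ring_nf
      _ ≤ _ := norm_add_le _ _
      _ ≤ R + 1 := by linarith [hclose z hz j le_rfl, hz0 z hz]
  have hAB : Disjoint A B := by
    rw [disjoint_left]
    rintro _ ⟨z, hz, rfl⟩ ⟨w, hw, hwz⟩
    have : w = z := hft.injOn (hfr hw) (hKj hz) hwz
    exact hw.2 (this ▸ hK j hz)
  obtain ⟨τ₀, hτ₀, hdisj₀⟩ := hAB.exists_thickenings hA hB.isClosed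
  set τ := min (1 / 3) (τ₀ / 3) with hτdef
  have hτ : 0 < τ := by positivity
  have hτ1 : τ ≤ 1 / 3 := min_le_left _ _
  have hτ2 : 3 * τ ≤ τ₀ := by linarith [min_le_right (1 / 3) (τ₀ / 3)]
  have hdisj : Disjoint (thickening (3 * τ) A) (thickening (3 * τ) B) :=
    hdisj₀.mono (thickening_mono hτ2 A) (thickening_mono hτ2 B)
  have hO : IsOpen (ball (-T : ℂ) (j * T + T / 2 + 1)) := isOpen_ball
  obtain ⟨δ, hδ, hdrift⟩ := exists_forall_iterate_close (hKc j) hO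
    (fun z hz i hi => (hft.analytic z hz i hi).continuousAt) (fun z hz i hi => by
      rw [mem_ball, dist_eq_norm, sub_neg_eq_add]
      -- For `j = 0` there is no `i < j`; otherwise `i ≤ j - 1`, which keeps the orbit point inside
      -- the old disc.
      cases j with
      | zero => omega
      | succ j =>
        have := norm_add_lt_of_close hR hT (Nat.lt_succ_iff.1 hi) (hz0 z hz) (hclose z hz i hi.le)
        linarith) hτ
  -- The bounds serve, in order: the old tolerance, a drift of less than `τ` after `j` steps,
  -- injectivity near `A`, and the displacement budget.
  set σ := min (min η δ) (min (τ / 4) ((1 / 2) ^ (j + 1))) with hσdef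
  have hσ : 0 < σ := lt_min (lt_min hf.pos hδ) (lt_min (by positivity) (by positivity))
  have hση : σ ≤ η := (min_le_left _ _).trans (min_le_left _ _)
  have hσδ : σ ≤ δ := (min_le_left _ _).trans (min_le_right _ _)
  have hστ : σ ≤ τ / 4 := (min_le_right _ _).trans (min_le_left _ _)
  have hσj : σ ≤ (1 / 2) ^ (j + 1) := (min_le_right _ _).trans (min_le_right _ _)
  obtain ⟨f', hm', ha', hp', hfA, hfB⟩ := IsStage.exists_approx hR hT hf.meromorphic hf.analytic
    hA hB ((image_mono hKj).trans hloc) ((image_mono hfr).trans hloc) hτ1 hτ hdisj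
    (half_pos hσ)
  refine ⟨f', σ / 2, ⟨half_pos hσ, hm', ha', ?_⟩, by linarith, hp'.mono subset_rfl (by linarith)⟩
  intro G hG
  have hballs : ball (-T : ℂ) (j * T + T / 2 + 1) ⊆
      ball (-T : ℂ) ((j + 1 : ℕ) * T + T / 2 + 1) := ball_subset_ball (by push_cast; linarith)
  have hGf := hp'.trans hG hballs
  rw [add_halves] at hGf
  have hGj := hf.tracks G (hGf.mono subset_rfl hση)
  have hdr := hdrift G fun x hx => (hGf.2 x hx).trans hσδ
  have hnear : ∀ {C : Set ℂ} {s : Set ℂ}, C = f^[j] '' s → s ⊆ K j → ∀ z ∈ s,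
      G^[j] z ∈ thickening τ C := by
    rintro C s rfl hs z hz
    exact mem_thickening_iff.2 ⟨_, mem_image_of_mem _ hz, by
      rw [dist_eq_norm]; exact hdr z (hs hz)⟩
  have hin : ∀ {C : Set ℂ}, C ⊆ closedBall (j * T : ℂ) (R + 1) → ∀ z ∈ thickening (2 * τ) C,
      z ∈ ball (-T : ℂ) ((j + 1 : ℕ) * T + T / 2 + 1) := by
    intro C hC z hz
    obtain ⟨w, hw, hzw⟩ := mem_thickening_iff.1 hz
    have h1 : ‖w - (j : ℕ) * T‖ ≤ R + 1 := by simpa [dist_eq_norm] using hC hw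
    rw [dist_eq_norm] at hzw
    have h2 : ‖((j : ℂ) + 1) * T‖ = (j + 1) * T := by
      have : ((j : ℂ) + 1) * T = (((j + 1) * T : ℝ) : ℂ) := by push_cast; ring
      rw [this, Complex.norm_real, Real.norm_of_nonneg (by positivity)]
    rw [mem_ball, dist_eq_norm, sub_neg_eq_add]
    have h3 : ‖z + T‖ ≤ (j + 1) * T + (‖z - w‖ + ‖w - j * T‖) := by
      rw [← h2]
      calc ‖z + T‖ = ‖((j : ℂ) + 1) * T + ((z - w) + (w - j * T))‖ := by ring_nf
        _ ≤ _ := (norm_add_le _ _).trans (by gcongr; exact norm_add_le _ _)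
    push_cast
    linarith
  refine hGj.succ hKj hτ (hnear hAdef hKj) (fun z hz => thickening_mono (by linarith) _
    (hnear hBdef hfr z hz)) hστ hσj (fun z hz => ?_) fun z hz => ?_
  · have hzO := hin ((image_mono hKj).trans hloc) z hz
    refine ⟨hG.analyticAt isOpen_ball hzO (hfA z hz).1, ?_⟩
    calc ‖G z - z - T‖ = ‖(G z - f' z) + (f' z - z - T)‖ := by ring_nf
      _ ≤ σ / 2 + σ / 2 := (norm_add_le _ _).trans (add_le_add (hG.2 z hzO) (hfA z hz).2)
      _ = σ := add_halves σ
  · have hzO := hin ((image_mono hfr).trans hloc) z hz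
    refine ⟨hG.analyticAt isOpen_ball hzO (hfB z hz).1, ?_⟩
    calc ‖G z + T‖ = ‖(G z - f' z) + (f' z + T)‖ := by ring_nf
      _ ≤ σ / 2 + σ / 2 := (norm_add_le _ _).trans (add_le_add (hG.2 z hzO) (hfB z hz).2)
      _ = σ := add_halves σ

/-- A sequence of successive holomorphic perturbations on an increasing sequence of open sets
converges. -/
theorem exists_limit_of_perturbations {f : ℕ → ℂ → ℂ} {η : ℕ → ℝ} {O : ℕ → Set ℂ}
    (hO : ∀ n, IsOpen (O n)) (hOm : Monotone O) (hOu : ∀ z, ∃ n, z ∈ O n) (hη : ∀ n, 0 < η n)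
    (hη2 : ∀ n, η (n + 1) ≤ η n / 2)
    (hp : ∀ n, IsPerturbationOn (f n) (f (n + 1)) (O n) (η n / 2)) :
    ∃ G : ℂ → ℂ, ∀ n, IsPerturbationOn (f n) G (O n) (η n) := by
  -- Telescoping: halving gives `η m / 2 ≤ η m - η (m + 1)`, so the total change never exceeds `η
  -- n`.
  have hp' : ∀ n k, IsPerturbationOn (f n) (f (n + k)) (O n) (η n - η (n + k)) := by
    intro n k
    induction k with
    | zero => simpa using IsPerturbationOn.refl (f n) (O n) le_rfl
    | succ k ih =>
      refine (ih.trans (hp (n + k)) (hOm (Nat.le_add_right n k))).mono subset_rfl ?_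
      have := hη2 (n + k)
      rw [← add_assoc]; linarith
  have hη0 : Tendsto η atTop (𝓝 0) := by
    have hle : ∀ n, η n ≤ η 0 * (1 / 2) ^ n := by
      intro n
      induction n with
      | zero => simp
      | succ n ih => rw [pow_succ]; linarith [hη2 n]
    refine squeeze_zero (fun n => (hη n).le) hle ?_
    simpa using (tendsto_pow_atTop_nhds_zero_of_lt_one (r := (1 / 2 : ℝ)) (by norm_num)
      (by norm_num)).const_mul (η 0)
  have hle : ∀ n m, n ≤ m → ∀ z ∈ O n, ‖f m z - f n z‖ ≤ η n := by
    intro n m hnm z hz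
    obtain ⟨k, rfl⟩ := Nat.exists_eq_add_of_le hnm
    exact ((hp' n k).2 z hz).trans (by linarith [hη (n + k)])
  have hlim : ∀ z, ∃ y, Tendsto (fun m => f m z) atTop (𝓝 y) := by
    intro z
    obtain ⟨n, hn⟩ := hOu z
    refine cauchySeq_tendsto_of_complete (Metric.cauchySeq_iff'.2 fun ε hε => ?_)
    obtain ⟨N, hN⟩ := (hη0.eventually (gt_mem_nhds hε)).exists_forall_of_atTop
    refine ⟨max N n, fun m hm => ?_⟩
    rw [dist_eq_norm]
    exact (hle _ _ hm z (hOm (le_max_right N n) hn)).trans_lt (hN _ (le_max_left _ _))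
  choose G hG using hlim
  have hGle : ∀ n, ∀ z ∈ O n, ‖G z - f n z‖ ≤ η n := fun n z hz =>
    le_of_tendsto ((hG z).sub_const (f n z)).norm
      (eventually_atTop.2 ⟨n, fun m hm => hle n m hm z hz⟩)
  refine ⟨G, fun n => ⟨?_, hGle n⟩⟩
  have hconv : TendstoLocallyUniformlyOn (fun m z => f m z - f n z) (fun z => G z - f n z) atTop
      (O n) := by
    refine TendstoUniformlyOn.tendstoLocallyUniformlyOn (Metric.tendstoUniformlyOn_iff.2 ?_)
    intro ε hε
    filter_upwards [hη0.eventually (gt_mem_nhds hε), eventually_ge_atTop n] with m hm hnm z hz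
    rw [dist_eq_norm, sub_sub_sub_cancel_right]
    exact (hGle m z (hOm hnm hz)).trans_lt hm
  refine hconv.differentiableOn ?_ (hO n)
  filter_upwards [eventually_ge_atTop n] with m hnm
  obtain ⟨k, rfl⟩ := Nat.exists_eq_add_of_le hnm
  exact (hp' n k).1

theorem exists_meromorphic_tracks (hR : 0 ≤ R) (hT : T = 2 * R + 10) (hKc : ∀ n, IsCompact (K n))
    (hK : ∀ n, K (n + 1) ⊆ interior (K n)) (hKR : ∀ n, K n ⊆ closedBall 0 R) :
    ∃ G : ℂ → ℂ, Meromorphic G ∧ (∀ z ∈ closedBall (-T : ℂ) 1, AnalyticAt ℂ G z) ∧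
      (∀ z ∈ closedBall (-T : ℂ) 1, ‖G z + T‖ ≤ 1 / 4) ∧
      (∀ z ∈ closedBall (-T : ℂ) 1, ∀ w ∈ closedBall (-T : ℂ) 1,
        ‖G z - G w‖ ≤ 1 / 2 * ‖z - w‖) ∧ ∀ j, Tracks K T j G := by
  have hT0 : 0 < T := by linarith
  -- The starting map is the constant `-T`. A perturbation by at most `1 / 4` has Lipschitz constant
  -- `2 * (1 / 4) / 1 = 1 / 2` on the unit disc about `-T`, which yields the contraction.
  have h0 : IsStage K T 0 (fun _ => (-T : ℂ)) (1 / 4) := by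
    refine ⟨by norm_num, fun z => analyticAt_const.meromorphicAt, fun z _ => analyticAt_const,
      fun G _ => ⟨fun z _ i hi => ?_, fun z _ i hi => absurd hi (Nat.not_lt_zero i),
        fun i hi => absurd hi (Nat.not_lt_zero i), injOn_id _⟩⟩
    obtain rfl : i = 0 := Nat.le_zero.1 hi
    simp
  choose! F E hs hE hFE using fun (j : ℕ) (f : ℂ → ℂ) (η : ℝ) (h : IsStage K T j f η) =>
    h.succ hR hT hKc hK hKR
  let s : ℕ → (ℂ → ℂ) × ℝ := fun n => Nat.rec (fun _ => (-T : ℂ), 1 / 4)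
    (fun j p => (F j p.1 p.2, E j p.1 p.2)) n
  have hstage : ∀ n, IsStage K T n (s n).1 (s n).2 := by
    intro n
    induction n with
    | zero => exact h0
    | succ n ih => exact hs n _ _ ih
  obtain ⟨G, hG⟩ := exists_limit_of_perturbations (f := fun n => (s n).1) (η := fun n => (s n).2)
    (O := fun n => ball (-T : ℂ) (n * T + T / 2 + 1)) (fun n => isOpen_ball)
    (fun m n hmn => ball_subset_ball (by
      have : (m : ℝ) ≤ n := by exact_mod_cast hmn
      nlinarith))
    (fun z => by
      obtain ⟨n, hn⟩ := exists_nat_gt (‖z + T‖ / T)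
      rw [div_lt_iff₀ hT0] at hn
      refine ⟨n, ?_⟩
      rw [mem_ball, dist_eq_norm, sub_neg_eq_add]
      linarith)
    (fun n => (hstage n).pos) (fun n => hE n _ _ (hstage n)) (fun n => hFE n _ _ (hstage n))
  have hG0 := hG 0
  have hball : ∀ z ∈ closedBall (-T : ℂ) 1,
      ball z 1 ⊆ ball (-T : ℂ) ((0 : ℕ) * T + T / 2 + 1) := by
    intro z hz
    refine ball_subset_ball' ?_
    rw [mem_closedBall] at hz
    push_cast
    linarith
  have hG0b : ∀ z ∈ ball (-T : ℂ) ((0 : ℕ) * T + T / 2 + 1), ‖G z + T‖ ≤ 1 / 4 := fun z hz => by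
    have : ‖G z - -T‖ ≤ 1 / 4 := hG0.2 z hz
    rwa [sub_neg_eq_add] at this
  refine ⟨G, fun z => ?_, fun z hz => hG0.analyticAt isOpen_ball
    (hball z hz (mem_ball_self one_pos)) analyticAt_const,
    fun z hz => hG0b z (hball z hz (mem_ball_self one_pos)), fun z hz w hw => ?_,
    fun j => (hstage j).tracks G (hG j)⟩
  · obtain ⟨n, hn⟩ := exists_nat_gt (‖z + T‖ / T)
    rw [div_lt_iff₀ hT0] at hn
    refine (hG n).meromorphicAt isOpen_ball ?_ ((hstage n).meromorphic z)
    rw [mem_ball, dist_eq_norm, sub_neg_eq_add]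
    linarith
  · have hd : DifferentiableOn ℂ (fun z => G z + T) (ball (-T : ℂ) ((0 : ℕ) * T + T / 2 + 1)) := by
      have := hG0.1
      refine this.congr fun z _ => ?_
      change G z + T = G z - -T
      ring
    have := norm_sub_le_of_norm_le_of_ball one_pos hball hd hG0b hz hw
    rw [add_sub_add_right_eq_sub] at this
    linarith

end Construction

/-! ### Sphere-valued iterates, normality, rationality and components. -/

namespace MeromorphicDynamics

open Metric

section Sphere

theorem exists_tendsto_coe_of_meromorphicAt {G : ℂ → ℂ} {z : ℂ} (h : MeromorphicAt G z) :
    ∃ y : Sphere, Tendsto (fun w => (G w : Sphere)) (𝓝[≠] z) (𝓝 y) := by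
  rcases lt_or_ge (meromorphicOrderAt G z) 0 with ho | ho
  · have h1 := tendsto_cobounded_of_meromorphicOrderAt_neg ho
    rw [cobounded_eq_cocompact, ← coclosedCompact_eq_cocompact] at h1
    exact ⟨∞, OnePoint.tendsto_coe_infty.comp h1⟩
  · obtain ⟨c, hc⟩ := tendsto_nhds_of_meromorphicOrderAt_nonneg h ho
    exact ⟨c, (OnePoint.continuous_coe.tendsto c).comp hc⟩

/-- The extension of a meromorphic function to a function with values in the sphere. -/
noncomputable def sphereExtension (G : ℂ → ℂ) (z : ℂ) : Sphere :=
  limUnder (𝓝[≠] z) fun w => (G w : Sphere)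

theorem isMeromorphic_sphereExtension {G : ℂ → ℂ} (hG : Meromorphic G) :
    IsMeromorphic (sphereExtension G) :=
  ⟨G, hG, fun z => tendsto_nhds_limUnder (exists_tendsto_coe_of_meromorphicAt (hG z))⟩

theorem sphereExtension_eq {G : ℂ → ℂ} {z : ℂ} (hG : AnalyticAt ℂ G z) :
    sphereExtension G z = G z :=
  Tendsto.limUnder_eq ((OnePoint.continuous_coe.tendsto (G z)).comp
    (hG.continuousAt.tendsto.mono_left nhdsWithin_le_nhds))

theorem iter_sphereExtension {G : ℂ → ℂ} {z : ℂ} {n : ℕ}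
    (h : ∀ i < n, AnalyticAt ℂ G (G^[i] z)) : iter (sphereExtension G) n z = G^[n] z := by
  induction n with
  | zero => rfl
  | succ n ih =>
    have h1 := ih fun i hi => h i (hi.trans (Nat.lt_succ_self n))
    change (iter (sphereExtension G) n z).elim ∞ (sphereExtension G) = _
    rw [h1, Function.iterate_succ_apply', ← sphereExtension_eq (h n (Nat.lt_succ_self n))]
    rfl

theorem mem_iterateDomain_sphereExtension {G : ℂ → ℂ} {z : ℂ} {n : ℕ}
    (h : ∀ i < n, AnalyticAt ℂ G (G^[i] z)) : z ∈ iterateDomain (sphereExtension G) n := by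
  intro k hk
  rw [iter_sphereExtension fun i hi => h i (hi.trans hk)]
  exact OnePoint.coe_ne_infty _

theorem tendstoUniformlyOn_const_iff {ι : Type*} {u : ι → ℂ → Sphere} {l : Filter ι} {y : Sphere}
    {U : Set ℂ} : TendstoUniformlyOn u (fun _ => y) l U ↔
      ∀ N ∈ 𝓝 y, ∀ᶠ n in l, ∀ z ∈ U, u n z ∈ N := by
  constructor
  · intro h N hN
    obtain ⟨V, hV, hVN⟩ := UniformSpace.mem_nhds_iff.1 hN
    filter_upwards [h V hV] with n hn z hz using hVN (hn z hz)
  · intro h V hV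
    filter_upwards [h _ (UniformSpace.ball_mem_nhds y hV)] with n hn z hz using hn z hz

/-- The indices of a sequence drawn from the family either tend to infinity, and it converges to
`g`, or some index recurs infinitely often, giving a constant subsequence. -/
theorem isNormalFamilyOn_of_tendstoUniformlyOn {v : ℕ → ℂ → Sphere} {g : ℂ → Sphere} {U : Set ℂ}
    (h : TendstoUniformlyOn v g atTop U) : IsNormalFamilyOn (range v) U := by
  intro u hu
  choose m hm using hu
  by_cases hc : Tendsto m cofinite atTop
  · refine ⟨id, strictMono_id, g, TendstoUniformlyOn.tendstoLocallyUniformlyOn ?_⟩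
    intro V hV
    have h1 : Tendsto m atTop atTop := by rwa [← Nat.cofinite_eq_atTop] at hc ⊢
    filter_upwards [h1.eventually (h V hV)] with k hk z hz
    simpa [hm] using hk z hz
  · obtain ⟨b, hb⟩ : ∃ b, ∃ᶠ k in atTop, m k = b := by
      by_contra! hcon
      refine hc ?_
      rw [← Nat.cofinite_eq_atTop]
      refine Tendsto.cofinite_of_finite_preimage_singleton fun b => ?_
      have := hcon b
      rw [← Nat.cofinite_eq_atTop, eventually_cofinite] at this
      refine this.subset fun k hk => ?_
      simpa using hk
    obtain ⟨φ, hφ, hφb⟩ := extraction_of_frequently_atTop hb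
    refine ⟨φ, hφ, v b, TendstoUniformlyOn.tendstoLocallyUniformlyOn fun V hV => ?_⟩
    refine Eventually.of_forall fun k z _ => ?_
    rw [← hm, hφb]
    exact refl_mem_uniformity hV

theorem subset_fatouSet {f : ℂ → Sphere} {U : Set ℂ} {g : ℂ → Sphere} (hU : IsOpen U)
    (hd : ∀ n, U ⊆ iterateDomain f n) (h : TendstoUniformlyOn (iter f) g atTop U) :
    U ⊆ fatouSet f :=
  subset_sUnion_of_mem ⟨hU, hd, isNormalFamilyOn_of_tendstoUniformlyOn h⟩

theorem eventually_notMem_closedBall_of_mem_nhds_infty {N : Set Sphere}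
    (hN : N ∈ 𝓝 (∞ : Sphere)) : ∃ r : ℝ, ∀ x : ℂ, r < ‖x‖ → (x : Sphere) ∈ N := by
  have h1 := OnePoint.tendsto_coe_infty (X := ℂ) hN
  rw [coclosedCompact_eq_cocompact, ← cobounded_eq_cocompact, mem_map,
    (hasBasis_cobounded_compl_closedBall (0 : ℂ)).mem_iff] at h1
  obtain ⟨r, -, hr⟩ := h1
  exact ⟨r, fun x hx => hr (by simpa using hx)⟩

theorem eval_inv_meromorphicAt (p : ℂ[X]) : MeromorphicAt (fun w : ℂ => p.eval w⁻¹) 0 := by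
  simp only [Polynomial.eval_eq_sum_range]
  exact MeromorphicAt.fun_sum fun i _ =>
    analyticAt_const.meromorphicAt.mul ((analyticAt_id.meromorphicAt.inv).pow i)

/-- A rational function has a limit at infinity, finite or infinite. -/
theorem tendsto_eval_div_eval_cobounded (p q : ℂ[X]) :
    (∃ a, Tendsto (fun z => p.eval z / q.eval z) (Bornology.cobounded ℂ) (𝓝 a)) ∨
      Tendsto (fun z => p.eval z / q.eval z) (Bornology.cobounded ℂ) (Bornology.cobounded ℂ) := by
  -- The substitution `w = 1 / z` turns behaviour at infinity into that of a meromorphic germ at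
  -- `0`.
  have hm := (eval_inv_meromorphicAt p).div (eval_inv_meromorphicAt q)
  have key : ∀ l, Tendsto ((fun w : ℂ => p.eval w⁻¹) / fun w : ℂ => q.eval w⁻¹) (𝓝[≠] 0) l →
      Tendsto (fun z => p.eval z / q.eval z) (Bornology.cobounded ℂ) l := by
    intro l hl
    refine (hl.comp tendsto_inv₀_cobounded').congr fun z => ?_
    simp
  rcases lt_or_ge (meromorphicOrderAt
      ((fun w : ℂ => p.eval w⁻¹) / fun w : ℂ => q.eval w⁻¹) 0) 0 with ho | ho
  · exact Or.inr (key _ (tendsto_cobounded_of_meromorphicOrderAt_neg ho))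
  · obtain ⟨a, ha⟩ := tendsto_nhds_of_meromorphicOrderAt_nonneg hm ho
    exact Or.inl ⟨a, key _ ha⟩

theorem not_isRational_of_sequences {f : ℂ → Sphere} {x y a b : ℕ → ℂ}
    (hx : Tendsto x atTop (Bornology.cobounded ℂ)) (hy : Tendsto y atTop (Bornology.cobounded ℂ))
    (hfx : ∀ n, f (x n) = a n) (hfy : ∀ n, f (y n) = b n)
    (ha : Tendsto a atTop (Bornology.cobounded ℂ)) (hb : Bornology.IsBounded (range b)) :
    ¬ IsRational f := by
  rintro ⟨p, q, hq, hf⟩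
  have hq0 : ∀ᶠ z in Bornology.cobounded ℂ, q.eval z ≠ 0 := by
    have h1 : {z | q.eval z = 0}.Finite :=
      (q.roots.toFinset.finite_toSet).subset fun z hz => by simpa [hq] using hz
    exact Bornology.isBounded_def.1 h1.isBounded
  have key : ∀ {x a : ℕ → ℂ}, Tendsto x atTop (Bornology.cobounded ℂ) → (∀ n, f (x n) = a n) →
      ∀ l, Tendsto (fun z => p.eval z / q.eval z) (Bornology.cobounded ℂ) l →
        Tendsto a atTop l := by
    intro x a hx hfx l hl
    refine (hl.comp hx).congr' ?_
    filter_upwards [hx.eventually hq0] with n hn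
    have := hf _ hn
    rw [hfx] at this
    exact (OnePoint.coe_injective this).symm
  rcases tendsto_eval_div_eval_cobounded p q with ⟨c, hc⟩ | hc
  · exact (disjoint_nhds_cobounded c).le_bot.not_gt <|
      (bot_lt_iff_ne_bot.2 (map_neBot (f := atTop) (m := a)).ne).trans_le
        (le_inf (key hx hfx _ hc) ha)
  · have h1 := key hy hfy _ hc
    obtain ⟨n, hn⟩ := (h1.eventually (Bornology.isBounded_def.1 hb)).exists
    exact hn (mem_range_self n)

end Sphere

section Components

theorem subset_of_isPreconnected_of_disjoint_frontier {X : Type*} [TopologicalSpace X]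
    {A S : Set X} (hA : IsPreconnected A) (hd : Disjoint A (frontier S)) (hne : (A ∩ S).Nonempty) :
    A ⊆ S := by
  have hint : ∀ x ∈ A, x ∈ closure S → x ∈ interior S := fun x hx hc => by
    by_contra h
    exact disjoint_left.1 hd hx ⟨hc, h⟩
  refine (hA.subset_left_of_subset_union isOpen_interior isClosed_closure.isOpen_compl
    (disjoint_left.2 fun x hx h => h (subset_closure (interior_subset hx))) ?_ ?_).trans
    interior_subset
  · intro x hx
    by_cases hc : x ∈ closure S
    · exact Or.inl (hint x hx hc)
    · exact Or.inr hc
  · obtain ⟨x, hx, hxS⟩ := hne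
    exact ⟨x, hx, hint x hx (subset_closure hxS)⟩

/-- If connected subsets of `S'` cannot leave `S`, components do not grow. All three component
claims reduce to this. -/
theorem isComponentOf_of_subset {S S' C : Set ℂ} (hS : S ⊆ S') (hC : IsComponentOf C S)
    (h : ∀ z ∈ S, ∀ A ⊆ S', IsPreconnected A → z ∈ A → A ⊆ S) : IsComponentOf C S' := by
  obtain ⟨z, hz, rfl⟩ := hC
  refine ⟨z, hS hz, (connectedComponentIn_mono z hS).antisymm ?_⟩
  have hzm := mem_connectedComponentIn (hS hz)
  exact isPreconnected_connectedComponentIn.subset_connectedComponentIn hzm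
    (h z hz _ (connectedComponentIn_subset _ _) isPreconnected_connectedComponentIn hzm)

end Components

end MeromorphicDynamics

/-! ### Dynamics of the constructed map. -/

namespace MeromorphicDynamics

open Metric

/-- The sets `K n` are compact neighbourhoods shrinking to `L`, and `G` is a meromorphic function
that tracks all of them and contracts the closed unit disc about `-T`. -/
structure IsTrackingModel (L : Set ℂ) (K : ℕ → Set ℂ) (R T : ℝ) (G : ℂ → ℂ) : Prop where
  nonneg : 0 ≤ R
  period_eq : T = 2 * R + 10
  isCompact : ∀ n, IsCompact (K n)
  subset_ball : ∀ n, K n ⊆ closedBall 0 R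
  subset_interior : ∀ n, L ⊆ interior (K n)
  mem_of_forall : ∀ z, (∀ n, z ∈ K n) → z ∈ L
  meromorphic : Meromorphic G
  disc_analytic : ∀ z ∈ closedBall (-T : ℂ) 1, AnalyticAt ℂ G z
  disc_close : ∀ z ∈ closedBall (-T : ℂ) 1, ‖G z + T‖ ≤ 1 / 4
  disc_lipschitz : ∀ z ∈ closedBall (-T : ℂ) 1, ∀ w ∈ closedBall (-T : ℂ) 1,
    ‖G z - G w‖ ≤ 1 / 2 * ‖z - w‖
  tracks : ∀ j, Tracks K T j G

theorem exists_isTrackingModel {L : Set ℂ} (hL : IsCompact L) :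
    ∃ K R T G, IsTrackingModel L K R T G := by
  set K : ℕ → Set ℂ := fun n => cthickening (1 / ((n : ℝ) + 1)) L with hK
  have hpos : ∀ n : ℕ, (0 : ℝ) < 1 / ((n : ℝ) + 1) := fun n => Nat.one_div_pos_of_nat
  have hc : ∀ n, IsCompact (K n) := fun n => hL.cthickening
  obtain ⟨r, hr⟩ := (hc 0).isBounded.subset_closedBall (0 : ℂ)
  have hlt : ∀ n : ℕ, 1 / (((n + 1 : ℕ) : ℝ) + 1) < 1 / ((n : ℝ) + 1) := fun n => by
    push_cast
    exact one_div_lt_one_div_of_lt (by positivity) (by linarith)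
  have hsucc : ∀ n, K (n + 1) ⊆ interior (K n) := fun n =>
    (cthickening_subset_thickening' (hpos n) (hlt n) L).trans
      (thickening_subset_interior_cthickening _ _)
  have hKR : ∀ n, K n ⊆ closedBall 0 (max r 0) := fun n =>
    (antitone_nat_of_succ_le (fun n => (hsucc n).trans interior_subset) (Nat.zero_le n)).trans
      (hr.trans (closedBall_subset_closedBall (le_max_left _ _)))
  obtain ⟨G, h1, h2, h3, h4, h5⟩ := exists_meromorphic_tracks (le_max_right r 0) rfl hc hsucc hKR
  refine ⟨K, max r 0, _, G, le_max_right r 0, rfl, hc, hKR, fun n => ?_, fun z hz => ?_, h1, h2, h3,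
    h4, h5⟩
  · exact (self_subset_thickening (hpos n) L).trans (thickening_subset_interior_cthickening _ _)
  · rw [← hL.isClosed.closure_eq, closure_eq_iInter_cthickening]
    refine mem_iInter₂.2 fun δ hδ => ?_
    obtain ⟨n, hn⟩ := exists_nat_one_div_lt hδ
    exact cthickening_mono hn.le L (hz n)

namespace IsTrackingModel

variable {L : Set ℂ} {K : ℕ → Set ℂ} {R T : ℝ} {G : ℂ → ℂ}

theorem period_pos (h : IsTrackingModel L K R T G) : 0 < T := by
  linarith [h.nonneg, h.period_eq]

theorem mem (h : IsTrackingModel L K R T G) {z : ℂ} (hz : z ∈ L) (n : ℕ) : z ∈ K n :=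
  interior_subset (h.subset_interior n hz)

theorem norm_le (h : IsTrackingModel L K R T G) {z : ℂ} {n : ℕ} (hz : z ∈ K n) : ‖z‖ ≤ R := by
  simpa using h.subset_ball n hz

theorem norm_iterate_sub_le (h : IsTrackingModel L K R T G) {n i : ℕ} {z : ℂ} (hz : z ∈ K n)
    (hi : i ≤ n) : ‖G^[i] z - z - i * T‖ ≤ 1 :=
  ((h.tracks n).close z hz i hi).trans (by linarith [show (0 : ℝ) < (1 / 2) ^ n by positivity])

theorem le_norm_iterate (h : IsTrackingModel L K R T G) {n i : ℕ} {z : ℂ} (hz : z ∈ K n)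
    (hi : i ≤ n) : i * T - R - 1 ≤ ‖G^[i] z‖ := by
  have h1 := h.norm_iterate_sub_le hz hi
  have h2 : ‖(i : ℂ) * T‖ = i * T := by
    rw [norm_mul, Complex.norm_real, Real.norm_of_nonneg h.period_pos.le, Complex.norm_natCast]
  have h3 : ‖(i : ℂ) * T‖ = ‖(G^[i] z - z) - (G^[i] z - z - i * T)‖ := by ring_nf
  have h4 := norm_sub_le (G^[i] z - z) (G^[i] z - z - i * T)
  have h5 := norm_sub_le (G^[i] z) z
  linarith [h.norm_le hz]

theorem analyticAt_iterate (h : IsTrackingModel L K R T G) {z : ℂ} (hz : z ∈ L) (i : ℕ) :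
    AnalyticAt ℂ G (G^[i] z) :=
  (h.tracks (i + 1)).analytic z (h.mem hz _) i (Nat.lt_succ_self i)

theorem iter_eq (h : IsTrackingModel L K R T G) {z : ℂ} (hz : z ∈ L) (n : ℕ) :
    iter (sphereExtension G) n z = G^[n] z :=
  iter_sphereExtension fun i _ => h.analyticAt_iterate hz i

theorem subset_iterateDomain (h : IsTrackingModel L K R T G) (n : ℕ) :
    L ⊆ iterateDomain (sphereExtension G) n := fun _ hz =>
  mem_iterateDomain_sphereExtension fun i _ => h.analyticAt_iterate hz i

theorem tendsto_natCast_mul_atTop (h : IsTrackingModel L K R T G) :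
    Tendsto (fun n : ℕ => n * T - R - 1) atTop atTop := by
  have := tendsto_natCast_atTop_atTop.atTop_mul_const h.period_pos
  exact (tendsto_atTop_add_const_right atTop (-R - 1) this).congr fun n => by ring

theorem tendstoUniformlyOn_infty (h : IsTrackingModel L K R T G) :
    TendstoUniformlyOn (iter (sphereExtension G)) (fun _ => ∞) atTop L := by
  rw [tendstoUniformlyOn_const_iff]
  intro N hN
  obtain ⟨r, hr⟩ := eventually_notMem_closedBall_of_mem_nhds_infty hN
  filter_upwards [h.tendsto_natCast_mul_atTop.eventually (eventually_gt_atTop r)] with n hn z hz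
  rw [h.iter_eq hz]
  exact hr _ (hn.trans_le (h.le_norm_iterate (h.mem hz n) le_rfl))

/-- The `n`-th image lies within distance `R + 1` of `n * T`, and `2 * R + 2 < T`. -/
theorem pairwise_disjoint_image (h : IsTrackingModel L K R T G) :
    Pairwise fun m n : ℕ => Disjoint (iter (sphereExtension G) m '' L)
      (iter (sphereExtension G) n '' L) := by
  intro m n hmn
  rw [Set.disjoint_left]
  rintro _ ⟨z, hz, rfl⟩ ⟨w, hw, hwz⟩
  rw [h.iter_eq hz, h.iter_eq hw] at hwz
  have h0 := OnePoint.coe_injective hwz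
  have h1 := h.norm_iterate_sub_le (h.mem hz m) le_rfl
  have h2 := h.norm_iterate_sub_le (h.mem hw n) le_rfl
  have h3 : ‖((m - n : ℝ) : ℂ) * T‖ ≤ 2 + 2 * R := by
    have : ((m - n : ℝ) : ℂ) * T =
        (G^[n] w - w - n * T) - (G^[m] z - z - m * T) + (w - z) := by
      rw [h0]; push_cast; ring
    rw [this]
    have h4 := norm_add_le ((G^[n] w - w - n * T) - (G^[m] z - z - m * T)) (w - z)
    have h5 := norm_sub_le (G^[n] w - w - n * T) (G^[m] z - z - m * T)
    have h6 := norm_sub_le w z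
    linarith [h.norm_le (h.mem hz 0), h.norm_le (h.mem hw 0)]
  rw [norm_mul, Complex.norm_real, Complex.norm_real, Real.norm_of_nonneg h.period_pos.le] at h3
  have h4 : (1 : ℝ) ≤ ‖(m - n : ℝ)‖ := by
    have : (1 : ℤ) ≤ |(m : ℤ) - n| := Int.one_le_abs (sub_ne_zero.2 (by exact_mod_cast hmn))
    rw [Real.norm_eq_abs]
    exact_mod_cast this
  have h5 := h.period_pos
  nlinarith [h.period_eq]

theorem subset_escapingSet (h : IsTrackingModel L K R T G) :
    L ⊆ escapingSet (sphereExtension G) := fun _ hz =>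
  ⟨fun n => h.subset_iterateDomain n hz, h.tendstoUniformlyOn_infty.tendsto_at hz⟩

theorem interior_subset_fatouSet (h : IsTrackingModel L K R T G) :
    interior L ⊆ fatouSet (sphereExtension G) :=
  subset_fatouSet isOpen_interior
    (fun n => interior_subset.trans (h.subset_iterateDomain n))
    (h.tendstoUniformlyOn_infty.mono interior_subset)

theorem iterate_mem_disc (h : IsTrackingModel L K R T G) {z : ℂ}
    (hz : z ∈ closedBall (-T : ℂ) 1) (k : ℕ) : G^[k] z ∈ closedBall (-T : ℂ) 1 := by
  induction k with
  | zero => exact hz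
  | succ k ih =>
    rw [Function.iterate_succ_apply', mem_closedBall, dist_eq_norm, sub_neg_eq_add]
    linarith [h.disc_close _ ih]

theorem exists_fixedPoint (h : IsTrackingModel L K R T G) :
    ∃ p : ℂ, ∀ z ∈ closedBall (-T : ℂ) 1, ∀ k, ‖G^[k] z - p‖ ≤ (1 / 2) ^ k * 2 := by
  have hmaps : MapsTo G (closedBall (-T : ℂ) 1) (closedBall (-T : ℂ) 1) := fun z hz =>
    h.iterate_mem_disc hz 1
  have hcon : ContractingWith (1 / 2) (hmaps.restrict G _ _) := by
    refine ⟨by rw [← NNReal.coe_lt_coe]; norm_num, LipschitzWith.of_dist_le_mul fun z w => ?_⟩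
    have := h.disc_lipschitz z z.2 w w.2
    rw [Subtype.dist_eq, Subtype.dist_eq, dist_eq_norm, dist_eq_norm]
    simpa using this
  obtain ⟨p, hp, hfp, -, -⟩ := hcon.exists_fixedPoint' isClosed_closedBall.isComplete hmaps
    (mem_closedBall_self zero_le_one) (edist_ne_top _ _)
  -- The factor `2` is the diameter of the disc, which contains both `z` and `p`.
  refine ⟨p, fun z hz k => ?_⟩
  induction k with
  | zero =>
    rw [mem_closedBall, dist_eq_norm] at hz hp
    have h1 : ‖z - p‖ = ‖(z - -T) - (p - -T)‖ := by ring_nf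
    have h2 := norm_sub_le (z - -T) (p - -T)
    simp only [Function.iterate_zero, id, pow_zero]
    linarith
  | succ k ih =>
    rw [Function.iterate_succ_apply']
    have h1 := h.disc_lipschitz _ (h.iterate_mem_disc hz k) p hp
    rw [hfp.eq] at h1
    rw [pow_succ]
    linarith

/-- Points near the boundary of `K n` are eventually captured by the disc about `-T`. -/
theorem exists_open_captured (h : IsTrackingModel L K R T G) {n : ℕ} {z₀ : ℂ}
    (hz₀ : z₀ ∈ frontier (K n)) :
    ∃ W, IsOpen W ∧ z₀ ∈ W ∧ ∀ z ∈ W, (∀ i, AnalyticAt ℂ G (G^[i] z)) ∧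
      G^[n + 1] z ∈ closedBall (-T : ℂ) 1 := by
  have han : ∀ i < n + 1, AnalyticAt ℂ G (G^[i] z₀) := by
    intro i hi
    rcases Nat.lt_or_eq_of_le (Nat.lt_succ_iff.1 hi) with hi | rfl
    · exact (h.tracks n).analytic z₀ ((h.isCompact n).isClosed.frontier_subset hz₀) i hi
    · exact ((h.tracks (i + 1)).captured i (Nat.lt_succ_self i) z₀ hz₀).1
  have hcont : ∀ i ≤ n + 1, ContinuousAt G^[i] z₀ := by
    intro i hi
    induction i with
    | zero => exact continuousAt_id
    | succ i ih =>
      rw [Function.iterate_succ']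
      exact (han i hi).continuousAt.comp (ih (Nat.le_of_succ_le hi))
  have h1 : ∀ᶠ z in 𝓝 z₀, ∀ i ∈ Finset.range (n + 1), AnalyticAt ℂ G (G^[i] z) := by
    rw [Filter.eventually_all_finset]
    intro i hi
    have hi' := Finset.mem_range.1 hi
    exact (hcont i hi'.le).eventually (han i hi').eventually_analyticAt
  have h2 : ∀ᶠ z in 𝓝 z₀, G^[n + 1] z ∈ closedBall (-T : ℂ) 1 := by
    refine (hcont (n + 1) le_rfl).eventually (mem_of_superset
      (isOpen_ball.mem_nhds (?_ : _ ∈ ball (-T : ℂ) 1)) ball_subset_closedBall)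
    rw [mem_ball, dist_eq_norm, sub_neg_eq_add]
    linarith [((h.tracks (n + 1)).captured n (Nat.lt_succ_self n) z₀ hz₀).2]
  obtain ⟨W, hW, hWo, hzW⟩ := _root_.eventually_nhds_iff.1 (h1.and h2)
  refine ⟨W, hWo, hzW, fun z hz => ⟨fun i => ?_, (hW z hz).2⟩⟩
  rcases lt_or_ge i (n + 1) with hi | hi
  · exact (hW z hz).1 i (Finset.mem_range.2 hi)
  · obtain ⟨k, rfl⟩ := Nat.exists_eq_add_of_le hi
    rw [add_comm, Function.iterate_add_apply]
    exact h.disc_analytic _ (h.iterate_mem_disc (hW z hz).2 k)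

theorem eventually_iter_mem (h : IsTrackingModel L K R T G) {n : ℕ} {z : ℂ}
    (han : ∀ i, AnalyticAt ℂ G (G^[i] z)) (hz : G^[n + 1] z ∈ closedBall (-T : ℂ) 1) :
    ∀ᶠ m in atTop, iter (sphereExtension G) m z ∈
      ((↑) : ℂ → Sphere) '' closedBall (-T : ℂ) 1 := by
  filter_upwards [eventually_ge_atTop (n + 1)] with m hm
  obtain ⟨k, rfl⟩ := Nat.exists_eq_add_of_le hm
  rw [iter_sphereExtension fun i _ => han i, add_comm, Function.iterate_add_apply]
  exact mem_image_of_mem _ (h.iterate_mem_disc hz k)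

theorem isClosed_coe_disc : IsClosed (((↑) : ℂ → Sphere) '' closedBall (-T : ℂ) 1) :=
  ((isCompact_closedBall _ _).image OnePoint.continuous_coe).isClosed

theorem coe_disc_compl_mem_nhds_infty :
    (((↑) : ℂ → Sphere) '' closedBall (-T : ℂ) 1)ᶜ ∈ 𝓝 (∞ : Sphere) := by
  refine isClosed_coe_disc.isOpen_compl.mem_nhds ?_
  rintro ⟨x, -, hx⟩
  exact OnePoint.coe_ne_infty x hx

/-- A whole neighbourhood enters the disc at the common time `n + 1` and then converges
geometrically to the fixed point, so the iterates converge uniformly. -/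
theorem frontier_subset_fatouSet (h : IsTrackingModel L K R T G) (n : ℕ) :
    frontier (K n) ⊆ fatouSet (sphereExtension G) := by
  intro z₀ hz₀
  obtain ⟨W, hWo, hzW, hW⟩ := h.exists_open_captured hz₀
  obtain ⟨p, hp⟩ := h.exists_fixedPoint
  refine subset_fatouSet (g := fun _ => (p : Sphere)) hWo (fun m z hz =>
    mem_iterateDomain_sphereExtension fun i _ => (hW z hz).1 i) ?_ hzW
  rw [tendstoUniformlyOn_const_iff]
  intro N hN
  have hN' : ((↑) : ℂ → Sphere) ⁻¹' N ∈ 𝓝 p := OnePoint.continuous_coe.continuousAt hN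
  obtain ⟨ε, hε, hεN⟩ := Metric.mem_nhds_iff.1 hN'
  have hlim : Tendsto (fun k : ℕ => (1 / 2 : ℝ) ^ k * 2) atTop (𝓝 0) := by
    simpa using (tendsto_pow_atTop_nhds_zero_of_lt_one (r := (1 / 2 : ℝ)) (by norm_num)
      (by norm_num)).mul_const 2
  obtain ⟨k₀, hk₀⟩ := (hlim.eventually (gt_mem_nhds hε)).exists_forall_of_atTop
  filter_upwards [eventually_ge_atTop (n + 1 + k₀)] with m hm z hz
  obtain ⟨k, rfl⟩ := Nat.exists_eq_add_of_le hm
  rw [iter_sphereExtension fun i _ => (hW z hz).1 i,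
    show n + 1 + k₀ + k = (k₀ + k) + (n + 1) by ring, Function.iterate_add_apply]
  refine hεN ?_
  rw [mem_ball, dist_eq_norm]
  exact (hp _ (hW z hz).2 _).trans_lt (hk₀ _ (Nat.le_add_right _ _))

theorem disjoint_closure_escapingSet (h : IsTrackingModel L K R T G) (n : ℕ) :
    Disjoint (closure (escapingSet (sphereExtension G))) (frontier (K n)) := by
  rw [Set.disjoint_left]
  intro z₀ hz₀ hf
  obtain ⟨W, hWo, hzW, hW⟩ := h.exists_open_captured hf
  obtain ⟨z, hzW, hz⟩ := mem_closure_iff.1 hz₀ W hWo hzW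
  obtain ⟨m, hm1, hm2⟩ := ((h.eventually_iter_mem (hW z hzW).1 (hW z hzW).2).and
    (hz.2.eventually coe_disc_compl_mem_nhds_infty)).exists
  exact hm2 hm1

theorem subset_of_isPreconnected (h : IsTrackingModel L K R T G) {A : Set ℂ}
    (hA : IsPreconnected A) (hd : ∀ n, Disjoint A (frontier (K n))) {z : ℂ} (hzA : z ∈ A)
    (hz : z ∈ L) : A ⊆ L := fun x hx => h.mem_of_forall x fun n =>
  subset_of_isPreconnected_of_disjoint_frontier hA (hd n) ⟨z, hzA, h.mem hz n⟩ hx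

/-- A small ball about `z` contains a point outside `L`, hence outside some `K n`, whereas `z`
belongs to every `K n`. The ball, being connected, crosses the frontier of that `K n`. -/
theorem exists_mem_frontier (h : IsTrackingModel L K R T G) {z : ℂ} (hz : z ∈ L)
    (hzf : z ∈ frontier L) {U : Set ℂ} (hU : U ∈ 𝓝 z) : ∃ n, (U ∩ frontier (K n)).Nonempty := by
  obtain ⟨ε, hε, hεU⟩ := Metric.mem_nhds_iff.1 hU
  rw [frontier_eq_closure_inter_closure] at hzf
  obtain ⟨w, hwε, hwL⟩ := mem_closure_iff.1 hzf.2 _ isOpen_ball (mem_ball_self hε)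
  by_contra! hcon
  refine hwL (h.mem_of_forall w fun n => ?_)
  refine subset_of_isPreconnected_of_disjoint_frontier (convex_ball z ε).isPreconnected ?_
    ⟨z, mem_ball_self hε, h.mem hz n⟩ hwε
  rw [Set.disjoint_iff_inter_eq_empty, ← Set.subset_empty_iff]
  exact (inter_subset_inter_left _ hεU).trans (hcon n).subset

/-- A subsequential limit `g` near `z` would be continuous at `z` with `g z = ∞`. Yet at points of
the frontiers of the `K n`, which come arbitrarily close to `z`, its value lies in the closed disc
about `-T`. -/
theorem frontier_subset_juliaSet (h : IsTrackingModel L K R T G) (hL : IsClosed L) :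
    frontier L ⊆ juliaSet (sphereExtension G) := by
  rintro z hz ⟨U, ⟨hUo, -, hUn⟩, hzU⟩
  have hzL := hL.frontier_subset hz
  obtain ⟨φ, hφ, g, hg⟩ := hUn (iter (sphereExtension G)) fun k => mem_range_self k
  have hgz : g z = ∞ := tendsto_nhds_unique (hg.tendsto_at hzU)
    ((h.tendstoUniformlyOn_infty.tendsto_at hzL).comp hφ.tendsto_atTop)
  have hcont : ∀ k, ContinuousAt (iter (sphereExtension G) k) z := by
    intro k
    have hit : ∀ i, ContinuousAt G^[i] z := by
      intro i
      induction i with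
      | zero => exact continuousAt_id
      | succ i ih =>
        rw [Function.iterate_succ']
        exact (h.analyticAt_iterate hzL i).continuousAt.comp ih
    have h1 : ∀ᶠ w in 𝓝 z, ∀ i ∈ Finset.range k, AnalyticAt ℂ G (G^[i] w) := by
      rw [Filter.eventually_all_finset]
      exact fun i _ => (hit i).eventually (h.analyticAt_iterate hzL i).eventually_analyticAt
    refine (OnePoint.continuous_coe.continuousAt.comp (hit k)).congr ?_
    filter_upwards [h1] with w hw
    exact (iter_sphereExtension fun i hi => hw i (Finset.mem_range.2 hi)).symm
  have hgc : ContinuousWithinAt g U z := by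
    refine continuousWithinAt_of_locally_uniform_approx_of_continuousWithinAt hzU fun V hV => ?_
    obtain ⟨t, ht, htV⟩ := hg V hV z hzU
    obtain ⟨k, hk⟩ := htV.exists
    exact ⟨t, ht, _, (hcont (φ k)).continuousWithinAt, hk⟩
  have hgc' := hgc.continuousAt (hUo.mem_nhds hzU)
  have hev : ∀ᶠ y in 𝓝 z, g y ∈ (((↑) : ℂ → Sphere) '' closedBall (-T : ℂ) 1)ᶜ :=
    hgc' (by rw [hgz]; exact coe_disc_compl_mem_nhds_infty)
  obtain ⟨n, y, ⟨hyg, hyU⟩, hyn⟩ := h.exists_mem_frontier hzL hz (hev.and (hUo.mem_nhds hzU))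
  obtain ⟨W, -, hyW, hW⟩ := h.exists_open_captured hyn
  exact hyg (isClosed_coe_disc.mem_of_tendsto (hg.tendsto_at hyU)
    (hφ.tendsto_atTop.eventually (h.eventually_iter_mem (hW y hyW).1 (hW y hyW).2)))

theorem isTranscendentalMeromorphic (h : IsTrackingModel L K R T G) (hne : L.Nonempty) :
    IsTranscendentalMeromorphic (sphereExtension G) := by
  refine ⟨isMeromorphic_sphereExtension h.meromorphic, ?_⟩
  obtain ⟨z, hz⟩ := hne
  -- The points `G^[n] z` and `G^[n] (w n)`, with `w n` on the frontier of `K n`, both tend to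
  -- infinity; `G` maps the former to an unbounded sequence and the latter into the disc.
  have hfr : ∀ n, (frontier (K n)).Nonempty := fun n => by
    refine nonempty_frontier_iff.2 ⟨⟨z, h.mem hz n⟩, fun hu => ?_⟩
    exact NoncompactSpace.noncompact_univ (X := ℂ) (hu ▸ h.isCompact n)
  choose w hw using hfr
  have hwK : ∀ n, w n ∈ K n := fun n => (h.isCompact n).isClosed.frontier_subset (hw n)
  have hcob : ∀ x : ℕ → ℂ, (∀ n, x n ∈ K n) →
      Tendsto (fun n => G^[n] (x n)) atTop (Bornology.cobounded ℂ) := fun x hx => by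
    rw [← tendsto_norm_atTop_iff_cobounded]
    exact tendsto_atTop_mono (fun n => h.le_norm_iterate (hx n) le_rfl) h.tendsto_natCast_mul_atTop
  have hzc := hcob (fun _ => z) fun n => h.mem hz n
  refine not_isRational_of_sequences (a := fun n => G^[n + 1] z) (b := fun n => G^[n + 1] (w n))
    hzc (hcob w hwK) (fun n => ?_) (fun n => ?_) (hzc.comp (tendsto_add_atTop_nat 1)) ?_
  · rw [sphereExtension_eq (h.analyticAt_iterate hz n), Function.iterate_succ_apply']
  · obtain ⟨W, -, hwW, hW⟩ := h.exists_open_captured (hw n)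
    rw [sphereExtension_eq ((hW _ hwW).1 n), Function.iterate_succ_apply']
  · refine (isBounded_closedBall (x := (-T : ℂ)) (r := 1)).subset ?_
    rintro _ ⟨n, rfl⟩
    obtain ⟨W, -, hwW, hW⟩ := h.exists_open_captured (hw n)
    exact (hW _ hwW).2

theorem isComponentOf_juliaSet (h : IsTrackingModel L K R T G) (hL : IsClosed L) {C : Set ℂ}
    (hC : IsComponentOf C (frontier L)) : IsComponentOf C (juliaSet (sphereExtension G)) := by
  refine isComponentOf_of_subset (h.frontier_subset_juliaSet hL) hC fun z hz A hAJ hA hzA => ?_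
  have hAL : A ⊆ L := h.subset_of_isPreconnected hA (fun n => Set.disjoint_left.2 fun x hx hxn =>
    hAJ hx (h.frontier_subset_fatouSet n hxn)) hzA (hL.frontier_subset hz)
  exact fun x hx => ⟨subset_closure (hAL hx), fun hxi => hAJ hx (h.interior_subset_fatouSet hxi)⟩

theorem isComponentOf_of_subset_closure_escapingSet (h : IsTrackingModel L K R T G) {S C : Set ℂ}
    (hLS : L ⊆ S) (hS : S ⊆ closure (escapingSet (sphereExtension G))) (hC : IsComponentOf C L) :
    IsComponentOf C S :=
  isComponentOf_of_subset hLS hC fun _ hz _ hAS hA hzA => h.subset_of_isPreconnected hA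
    (fun n => (h.disjoint_closure_escapingSet n).mono_left (hAS.trans hS)) hzA hz

theorem isWanderingDomain (h : IsTrackingModel L K R T G) (hL : IsClosed L) {U : Set ℂ}
    (hU : IsComponentOf U (interior L)) : IsWanderingDomain (sphereExtension G) U := by
  have hUL : U ⊆ L := by
    obtain ⟨z, -, rfl⟩ := hU
    exact (connectedComponentIn_subset _ _).trans interior_subset
  refine ⟨isComponentOf_of_subset h.interior_subset_fatouSet hU fun z hz A hAF hA hzA => ?_,
    fun m n hmn => (h.pairwise_disjoint_image hmn).mono (image_mono hUL) (image_mono hUL)⟩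
  -- The boundary of `L` lies in the Julia set, so a connected subset of the Fatou set cannot cross
  -- it.
  have hd : Disjoint A (frontier L) := Set.disjoint_left.2 fun x hx hxf =>
    h.frontier_subset_juliaSet hL hxf (hAF hx)
  have hAL := subset_of_isPreconnected_of_disjoint_frontier hA hd ⟨z, hzA, interior_subset hz⟩
  intro x hx
  by_contra hxi
  exact Set.disjoint_left.1 hd hx ⟨subset_closure (hAL hx), hxi⟩

end IsTrackingModel

end MeromorphicDynamics

theorem theorem1p3 (K : Set ℂ) (hK : IsCompact K) :
    ∃ f : ℂ → MeromorphicDynamics.Sphere,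
      MeromorphicDynamics.IsTranscendentalMeromorphic f ∧
      (∀ n, K ⊆ MeromorphicDynamics.iterateDomain f n) ∧
      TendstoUniformlyOn (MeromorphicDynamics.iter f) (fun _ => ∞) atTop K ∧
      (Pairwise fun m n : ℕ =>
        Disjoint (MeromorphicDynamics.iter f m '' K) (MeromorphicDynamics.iter f n '' K)) ∧
      (∀ C, MeromorphicDynamics.IsComponentOf C (frontier K) →
        MeromorphicDynamics.IsComponentOf C (MeromorphicDynamics.juliaSet f)) ∧
      (∀ C, MeromorphicDynamics.IsComponentOf C K →
        MeromorphicDynamics.IsComponentOf C (MeromorphicDynamics.escapingSet f) ∧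
        MeromorphicDynamics.IsComponentOf C (closure (MeromorphicDynamics.escapingSet f))) ∧
      (∀ U, MeromorphicDynamics.IsComponentOf U (interior K) →
        MeromorphicDynamics.IsWanderingDomain f U) := by
  rcases K.eq_empty_or_nonempty with rfl | hne
  · -- any transcendental meromorphic function will do
    obtain ⟨_, _, _, G, h⟩ := MeromorphicDynamics.exists_isTrackingModel
      (isCompact_singleton (x := (0 : ℂ)))
    refine ⟨_, h.isTranscendentalMeromorphic (singleton_nonempty 0), fun n => empty_subset _,
      tendstoUniformlyOn_empty, fun m n _ => by simp, ?_, ?_, ?_⟩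
    · rintro C ⟨z, hz, -⟩; simp at hz
    · rintro C ⟨z, hz, -⟩; simp at hz
    · rintro C ⟨z, hz, -⟩; simp at hz
  · obtain ⟨_, _, _, G, h⟩ := MeromorphicDynamics.exists_isTrackingModel hK
    exact ⟨_, h.isTranscendentalMeromorphic hne, h.subset_iterateDomain, h.tendstoUniformlyOn_infty,
      h.pairwise_disjoint_image, fun C hC => h.isComponentOf_juliaSet hK.isClosed hC,
      fun C hC =>
        ⟨h.isComponentOf_of_subset_closure_escapingSet h.subset_escapingSet subset_closure hC,
          h.isComponentOf_of_subset_closure_escapingSet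
            (h.subset_escapingSet.trans subset_closure) subset_rfl hC⟩,
      fun U hU => h.isWanderingDomain hK.isClosed hU⟩
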